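/- Let $q$ be a power of a prime, $s$ an odd positive integer, and let $G$ be a (multiplicatively written) abelian group of order $(q^s+1)(q^{2s}+1)$. Let $D\subseteq G$ be a difference set with parameters $(v,k,\lambda)=\big((q^s+1)(q^{2s}+1),\,q^{2s}+q^s+1,\,q^s+1\big)$, that is, $|D|=k$ and $DD^{(-1)}=\lambda G+(k-\lambda)1$ in $\mathbb{Z}G$, where a subset of $G$ also denotes the sum of its elements in $\mathbb{Z}G$ and $D^{(-1)}=\sum_{d\in D}d^{-1}$. Suppose $D$ is normalized, i.e. $\prod_{d\in D}d=1$. Let $M$ be a subgroup of $G$ of order $(q+1)(q^2+1)$. Assume that for every prime $r$ dividing $\gcd(q+1,s)$ or $\gcd(q^2+1,s)$ the Sylow $r$-subgroup of $G$ is cyclic. Then $$|D\cap M|=q^2+q+1 .$$ Moreover, $G$ has a unique subgroup $H$ of order $q^s+1$; the Sylow $2$-subgroup of $G$ is cyclic and contained in $M$; and $|H\cap M|=q+1$. If $z$ is any generator of the Sylow $2$-subgroup of $G$ (so $z=1$ if $q$ is even), and $m_1=z,m_2,\dots,m_{q^2+1}$ is any complete system of representatives of the cosets of $H\cap M$ in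 $M$, then for each $i\ge 2$ there is exactly one $h_i\in H$ with $h_im_i\in D$, this $h_i$ lies in $H\cap M$, and $$D\cap M=(H\cap M)z\,\cup\,\{h_im_i : i=2,\dots,q^2+1\}.$$ -/

import Mathlib

/-- The element `∑ d ∈ D, d` of the integral group ring `ℤG`. -/
noncomputable def groupRingSum {G : Type*} [Group G] (D : Finset G) : MonoidAlgebra ℤ G :=
  ∑ d ∈ D, MonoidAlgebra.single d 1

/-- The element `D⁽⁻¹⁾ = ∑ d ∈ D, d⁻¹` of the integral group ring `ℤG`. -/
noncomputable def groupRingSumInv {G : Type*} [Group G] (D : Finset G) : MonoidAlgebra ℤ G :=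
  ∑ d ∈ D, MonoidAlgebra.single d⁻¹ 1

/-- `D` is a `(v, k, l)`-difference set in the finite group `G`: `G` has order `v`, `D` is a
`k`-subset of `G` with `k ≥ 1`, and `D D⁽⁻¹⁾ = l G + n 1` in `ℤG`, where `n = k - l`. -/
structure IsDifferenceSet {G : Type*} [Group G] [Fintype G] (D : Finset G) (v k l : ℕ) :
    Prop where
  card_group : Fintype.card G = v
  card_set : D.card = k
  one_le : 1 ≤ k
  mul_eq : groupRingSum D * groupRingSumInv D =
    (l : ℤ) • groupRingSum (Finset.univ : Finset G) +
      ((k : ℤ) - (l : ℤ)) • (1 : MonoidAlgebra ℤ G)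

/-- A subset of a finite abelian group is normalized if the product of its elements is `1`. -/
def IsNormalized {G : Type*} [CommGroup G] (D : Finset G) : Prop :=
  ∏ d ∈ D, d = 1

/-- `m` lists the elements of a complete system of representatives in `M` of the cosets `A x`
of the subgroup `A` (of `M`). -/
def IsCosetRepresentatives {G : Type*} [Group G] {ι : Type*} (A M : Subgroup G) (m : ι → G) :
    Prop :=
  (∀ i, m i ∈ M) ∧ ∀ x ∈ M, ∃! i, x * (m i)⁻¹ ∈ A

/-! Write `Q = q ^ s`, a power of a prime `p`; then `n = k - λ = Q²` is a power of `p` exceeding `λ`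
and prime to `|G|`. Hence `p` is a multiplier, and normalization makes `D` invariant under `d ↦ d ^
p` (`IsDifferenceSet.pow_mem`).

Let `|H| = Q + 1`. Since `|G/H| = Q² + 1`, raising to the power `Q²` inverts `G/H`, so the image `A`
of `D` in `ℤ[G/H]` equals its own inverse. With `U` the sum of all elements of `G/H`, the difference
set equation becomes `(A - U)² = Q²`. As `p` does not divide `|G/H|`, this forces `Q ∣ A - U`, and
positivity gives `A = U + Q c` with `c² = 1`: `D` contains one coset of `H` and meets every other
once (`exists_coset`). Comparing two such subgroups shows that `H` is unique (`eq_of_card_eq`);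
uniqueness makes the Sylow 2-subgroup cyclic, and normalization identifies the coset `c` as `Hz`.

Finally, the power `q⁴` fixes `M` pointwise and preserves `D`. It therefore fixes the single element
of `D` in any nonexceptional coset of `H` that meets `M`. The Sylow hypothesis puts every element
with `x ^ (q⁴ - 1) = 1` in `M` (`mem_of_pow_pow_four_sub_one_eq_one`), so this element is in `M`.
Counting gives `(q + 1) + q²`. -/

/-! ### Divisibility by integers in `ℤG` -/

theorem MonoidAlgebra.coeff_natCast_mul {G : Type*} [Monoid G] (n : ℕ) (X : MonoidAlgebra ℤ G)
    (g : G) : ((n : MonoidAlgebra ℤ G) * X).coeff g = n * X.coeff g := by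
  rw [MonoidAlgebra.natCast_def, MonoidAlgebra.coeff_single_one_mul]

theorem MonoidAlgebra.natCast_dvd_iff {G : Type*} [Monoid G] (n : ℕ) (X : MonoidAlgebra ℤ G) :
    (n : MonoidAlgebra ℤ G) ∣ X ↔ ∀ g, (n : ℤ) ∣ X.coeff g := by
  constructor
  · rintro ⟨Y, rfl⟩ g
    rw [coeff_natCast_mul]
    exact dvd_mul_right _ _
  · intro h
    refine ⟨.ofCoeff (X.coeff.mapRange (fun z => z / (n : ℤ)) (by simp)), ?_⟩
    ext g
    rw [coeff_natCast_mul]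
    simp [Int.mul_ediv_cancel' (h g)]

theorem MonoidAlgebra.natCast_mul_left_injective {G : Type*} [Monoid G] {n : ℕ} (hn : n ≠ 0)
    {X Y : MonoidAlgebra ℤ G} (h : (n : MonoidAlgebra ℤ G) * X = n * Y) : X = Y := by
  ext g
  have := congrArg (fun Z => Z.coeff g) h
  simpa [coeff_natCast_mul, hn] using this

/-- The ring endomorphism `X ↦ X⁽ᵗ⁾` of `ℤG` raising all group elements to the power `t`. -/
noncomputable def powMap (G : Type*) [CommGroup G] (t : ℕ) :
    MonoidAlgebra ℤ G →+* MonoidAlgebra ℤ G :=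
  MonoidAlgebra.mapDomainRingHom ℤ (powMonoidHom t : G →* G)

/-! ### Power maps and congruences modulo powers of `p` -/

section
variable {G : Type*} [CommGroup G]

theorem powMap_single (t : ℕ) (g : G) (r : ℤ) :
    powMap G t (MonoidAlgebra.single g r) = MonoidAlgebra.single (g ^ t) r := by
  simp [powMap]

theorem powMap_mul (a b : ℕ) (X : MonoidAlgebra ℤ G) :
    powMap G (a * b) X = powMap G b (powMap G a X) := by
  induction X using MonoidAlgebra.induction_linear with
  | zero => simp
  | add X Y hX hY => simp [hX, hY]
  | single g r => simp [powMap_single, pow_mul]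

theorem powMap_eq_self {t : ℕ} (ht : ∀ g : G, g ^ t = g) (X : MonoidAlgebra ℤ G) :
    powMap G t X = X := by
  induction X using MonoidAlgebra.induction_linear with
  | zero => simp
  | add X Y hX hY => simp [hX, hY]
  | single g r => simp [powMap_single, ht]

theorem natCast_dvd_powMap_sub_pow {p : ℕ} (hp : p.Prime) (X : MonoidAlgebra ℤ G) :
    (p : MonoidAlgebra ℤ G) ∣ powMap G p X - X ^ p := by
  induction X using MonoidAlgebra.induction_linear with
  | zero => simp [hp.ne_zero]
  | add X Y hX hY =>
    rw [add_pow_prime_eq hp, map_add]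
    have (S : MonoidAlgebra ℤ G) : powMap G p X + powMap G p Y - (X ^ p + Y ^ p + p * X * Y * S) =
      (powMap G p X - X ^ p) + (powMap G p Y - Y ^ p) - p * (X * Y * S) := by ring
    rw [this]
    exact dvd_sub (dvd_add hX hY) (dvd_mul_right _ _)
  | single g r =>
    rw [powMap_single, MonoidAlgebra.single_pow, ← MonoidAlgebra.single_sub,
      MonoidAlgebra.natCast_dvd_iff]
    intro x
    have := Fact.mk hp
    have h : (p : ℤ) ∣ r - r ^ p := by
      rw [← ZMod.intCast_zmod_eq_zero_iff_dvd]
      simp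
    classical
    rw [MonoidAlgebra.coeff_single, Finsupp.single_apply]
    split_ifs
    · exact h
    · simp

theorem natCast_dvd_powMap_pow_sub_pow {p : ℕ} (hp : p.Prime) (f : ℕ) (X : MonoidAlgebra ℤ G) :
    (p : MonoidAlgebra ℤ G) ∣ powMap G (p ^ f) X - X ^ p ^ f := by
  induction f with
  | zero =>
    rw [pow_zero, pow_one, powMap_eq_self (by simp), sub_self]
    exact dvd_zero _
  | succ f ih =>
    have h1 : (p : MonoidAlgebra ℤ G) ∣ powMap G p (powMap G (p ^ f) X) -
        powMap G (p ^ f) X ^ p := natCast_dvd_powMap_sub_pow hp _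
    have h2 := ih.trans (sub_dvd_pow_sub_pow (powMap G (p ^ f) X) (X ^ p ^ f) p)
    rw [pow_succ, powMap_mul, pow_mul]
    simpa using dvd_add h1 h2

/-- For `f = φ(|G|)` the power `p ^ f` fixes every group element, so the Frobenius congruence reads
`X ^ p ^ f ≡ X`. This replaces semisimplicity of `ℤG/p`. -/
theorem natCast_dvd_pow_sub_self [Finite G] {p : ℕ} (hp : p.Prime) (hG : p.Coprime (Nat.card G)) :
    ∃ f, 0 < f ∧ ∀ X : MonoidAlgebra ℤ G, (p : MonoidAlgebra ℤ G) ∣ X ^ p ^ f - X := by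
  refine ⟨(Nat.card G).totient, Nat.totient_pos.2 Nat.card_pos, fun X => ?_⟩
  have h : ∀ g : G, g ^ p ^ (Nat.card G).totient = g := by
    intro g
    have := Nat.ModEq.pow_totient hG
    conv_rhs => rw [← pow_one g]
    rw [pow_eq_pow_iff_modEq]
    exact this.of_dvd (orderOf_dvd_natCard g)
  have := natCast_dvd_powMap_pow_sub_pow hp (Nat.card G).totient X
  rw [powMap_eq_self h] at this
  rwa [dvd_sub_comm]

/-- `ℤG/p` is reduced because `X ^ p ^ f ≡ X`; so `p ∣ X`, and one factor `p` is cancelled at a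
time. -/
theorem natCast_dvd_of_dvd_sq [Finite G] {p : ℕ} (hp : p.Prime) (hG : p.Coprime (Nat.card G))
    (e : ℕ) {X : MonoidAlgebra ℤ G} (hX : ((p ^ (2 * e) : ℕ) : MonoidAlgebra ℤ G) ∣ X ^ 2) :
    ((p ^ e : ℕ) : MonoidAlgebra ℤ G) ∣ X := by
  induction e generalizing X with
  | zero => simp
  | succ e ih =>
    obtain ⟨f, hf, h⟩ := natCast_dvd_pow_sub_self (G := G) hp hG
    have h1 : (p : MonoidAlgebra ℤ G) ∣ X ^ p ^ f := by
      refine dvd_trans ?_ (hX.trans (pow_dvd_pow X ?_))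
      · exact_mod_cast dvd_pow_self (p : MonoidAlgebra ℤ G) (by omega : 2 * (e + 1) ≠ 0)
      · calc 2 ≤ p := hp.two_le
          _ ≤ p ^ f := Nat.le_self_pow hf.ne' p
    obtain ⟨Y, rfl⟩ := (dvd_sub_right h1).1 (h X)
    have : ((p ^ (2 * e) : ℕ) : MonoidAlgebra ℤ G) ∣ Y ^ 2 := by
      obtain ⟨Z, hZ⟩ := hX
      refine ⟨Z, MonoidAlgebra.natCast_mul_left_injective (n := p ^ 2) (pow_ne_zero _ hp.ne_zero) ?_⟩
      push_cast at hZ ⊢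
      rw [← mul_pow, hZ]
      ring
    rw [pow_succ', Nat.cast_mul]
    exact mul_dvd_mul_left _ (ih this)

/-- The core of the multiplier theorem. Split `X = eX + (X - eX)` with `e` an approximate idempotent
that is a multiple of `X`. Then `e` kills `Y` and is fixed by the power map, both modulo `p ^ (a +
1)`, while `X - eX` is divisible by `p` and is handled by induction. -/
theorem natCast_dvd_powMap_mul [Finite G] {p : ℕ} (hp : p.Prime) (hG : p.Coprime (Nat.card G))
    (a : ℕ) {X Y : MonoidAlgebra ℤ G} (h : ((p ^ a : ℕ) : MonoidAlgebra ℤ G) ∣ X * Y) :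
    ((p ^ a : ℕ) : MonoidAlgebra ℤ G) ∣ powMap G p X * Y := by
  induction a generalizing X with
  | zero => simp
  | succ a ih =>
    obtain ⟨f, hf, hpow⟩ := natCast_dvd_pow_sub_self (G := G) hp hG
    have hpf : 2 ≤ p ^ f := hp.two_le.trans (Nat.le_self_pow hf.ne' p)
    obtain ⟨r, hr⟩ : ∃ r, p ^ f = r + 2 := ⟨p ^ f - 2, by omega⟩
    -- `e ≡ 1` on the components of `ℤG / p` where `X` is a unit, and `e ≡ 0` on the others
    set e₀ := X ^ (r + 1) with he₀
    -- The exponent `p ^ a` lifts the congruence `powMap G p e₀ ≡ e₀` from modulus `p` to modulus `p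
    -- ^ (a + 1)`.
    set e := e₀ ^ p ^ a with he
    have he₀X : (p : MonoidAlgebra ℤ G) ∣ e₀ * X - X := by
      have := hpow X
      rwa [hr, show X ^ (r + 2) = X ^ (r + 1) * X from pow_succ X (r + 1)] at this
    have hpowX : ∀ m, (p : MonoidAlgebra ℤ G) ∣ e₀ ^ m * X - X := by
      intro m
      induction m with
      | zero => simp
      | succ m ihm =>
        have : e₀ ^ (m + 1) * X - X = e₀ ^ m * (e₀ * X - X) + (e₀ ^ m * X - X) := by ring
        rw [this]
        exact dvd_add (he₀X.mul_left _) ihm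
    have he₀p : (p : MonoidAlgebra ℤ G) ∣ e₀ ^ p - e₀ := by
      obtain ⟨t, ht⟩ : ∃ t, p = t + 1 := ⟨p - 1, by have := hp.pos; omega⟩
      have : e₀ ^ p - e₀ = X ^ r * (e₀ ^ t * X - X) := by
        rw [ht, he₀]; ring
      rw [this]
      exact (hpowX t).mul_left _
    have hφe₀ : (p : MonoidAlgebra ℤ G) ∣ powMap G p e₀ - e₀ := by
      simpa using dvd_add (natCast_dvd_powMap_sub_pow hp e₀) he₀p
    have hφe : ((p ^ (a + 1) : ℕ) : MonoidAlgebra ℤ G) ∣ powMap G p e - e := by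
      have := dvd_sub_pow_of_dvd_sub hφe₀ a
      rw [he, map_pow]
      exact_mod_cast this
    have heY : ((p ^ (a + 1) : ℕ) : MonoidAlgebra ℤ G) ∣ e * Y := by
      obtain ⟨t, ht⟩ : ∃ t, p ^ a = t + 1 := ⟨p ^ a - 1, by have := pow_pos hp.pos a; omega⟩
      have : e * Y = e₀ ^ t * X ^ r * (X * Y) := by rw [he, ht, he₀]; ring
      rw [this]
      exact h.mul_left _
    obtain ⟨X', hX'⟩ : (p : MonoidAlgebra ℤ G) ∣ X - e * X := by
      rw [dvd_sub_comm]; exact hpowX _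
    have hX'Y : ((p ^ a : ℕ) : MonoidAlgebra ℤ G) ∣ X' * Y := by
      have : ((p ^ (a + 1) : ℕ) : MonoidAlgebra ℤ G) ∣ (X - e * X) * Y := by
        have h2 : (X - e * X) * Y = X * Y - X * (e * Y) := by ring
        rw [h2]
        exact dvd_sub h (heY.mul_left _)
      obtain ⟨Z, hZ⟩ := this
      refine ⟨Z, MonoidAlgebra.natCast_mul_left_injective hp.ne_zero ?_⟩
      rw [← mul_assoc, ← hX', hZ, pow_succ']
      push_cast
      ring
    obtain ⟨Z, hZ⟩ := ih hX'Y
    have key : powMap G p X * Y = (p : MonoidAlgebra ℤ G) * (powMap G p X' * Y) +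
        powMap G p X * ((powMap G p e - e) * Y) + powMap G p X * (e * Y) := by
      have h3 := congrArg (powMap G p) hX'
      rw [map_sub, map_mul, map_mul, map_natCast] at h3
      linear_combination Y * h3
    rw [key]
    refine dvd_add (dvd_add ?_ ((hφe.mul_right _).mul_left _)) (heY.mul_left _)
    rw [hZ, pow_succ', Nat.cast_mul]
    exact mul_dvd_mul_left _ (dvd_mul_right _ _)

end

/-! ### Coefficients and augmentation -/

theorem MonoidAlgebra.coeff_sum_single {G ι : Type*} [DecidableEq G] (s : Finset ι)
    (f : ι → G) (x : G) :
    (∑ i ∈ s, (MonoidAlgebra.single (f i) 1 : MonoidAlgebra ℤ G)).coeff x =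
      ((s.filter fun i => f i = x).card : ℤ) := by
  rw [MonoidAlgebra.coeff_sum, Finsupp.finsetSum_apply]
  simp [Finsupp.single_apply, Finset.sum_boole]

theorem exists_eq_ite_of_sum_eq {ι : Type*} [Fintype ι] [DecidableEq ι] {n : ℤ} (hn : 0 < n)
    (f : ι → ℤ) (hdvd : ∀ i, n ∣ f i) (hlt : ∀ i, -n < f i) (hsum : ∑ i, f i = n) :
    ∃ i₀, ∀ i, f i = if i = i₀ then n else 0 := by
  have hnonneg : ∀ i, 0 ≤ f i := by
    intro i
    obtain ⟨c, hc⟩ := hdvd i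
    have := hlt i
    rw [hc] at this ⊢
    have : -1 < c := by nlinarith
    exact mul_nonneg hn.le (by omega)
  obtain ⟨i₀, hi₀⟩ : ∃ i, f i ≠ 0 := by
    by_contra! h
    simp [h] at hsum
    omega
  have hle : n ≤ f i₀ := Int.le_of_dvd (lt_of_le_of_ne (hnonneg _) hi₀.symm) (hdvd _)
  rw [← Finset.add_sum_erase _ _ (Finset.mem_univ i₀)] at hsum
  have h0 : 0 ≤ ∑ i ∈ Finset.univ.erase i₀, f i := Finset.sum_nonneg fun i _ => hnonneg i
  have hz : ∑ i ∈ Finset.univ.erase i₀, f i = 0 := by omega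
  rw [Finset.sum_eq_zero_iff_of_nonneg fun i _ => hnonneg i] at hz
  refine ⟨i₀, fun i => ?_⟩
  split_ifs with h
  · subst h; omega
  · exact hz i (by simp [h])

/-- The augmentation map of the integral group ring. -/
noncomputable def augmentation (G : Type*) [Monoid G] : MonoidAlgebra ℤ G →+* ℤ :=
  (MonoidAlgebra.lift ℤ ℤ G 1).toRingHom

theorem augmentation_single {G : Type*} [Monoid G] (g : G) (r : ℤ) :
    augmentation G (MonoidAlgebra.single g r) = r := by
  simp [augmentation]

theorem augmentation_eq_sum {G : Type*} [Monoid G] [Fintype G] (X : MonoidAlgebra ℤ G) :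
    augmentation G X = ∑ g, X.coeff g := by
  classical
  induction X using MonoidAlgebra.induction_linear with
  | zero => simp
  | add X Y hX hY => simp [hX, hY, Finset.sum_add_distrib]
  | single g r => simp [augmentation_single, Finsupp.single_apply]

theorem augmentation_groupRingSum {G : Type*} [Group G] (D : Finset G) :
    augmentation G (groupRingSum D) = D.card := by
  simp [groupRingSum, augmentation_single]

theorem augmentation_groupRingSumInv {G : Type*} [Group G] (D : Finset G) :
    augmentation G (groupRingSumInv D) = D.card := by
  simp [groupRingSumInv, augmentation_single]

theorem coeff_groupRingSum_univ {G : Type*} [Group G] [Fintype G] (g : G) :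
    (groupRingSum (Finset.univ : Finset G)).coeff g = 1 := by
  classical
  rw [groupRingSum, MonoidAlgebra.coeff_sum_single, Nat.cast_eq_one]
  exact Finset.card_eq_one.2 ⟨g, by ext; simp⟩

theorem mul_groupRingSum_univ {G : Type*} [Group G] [Fintype G] (X : MonoidAlgebra ℤ G) :
    X * groupRingSum (Finset.univ : Finset G) =
      augmentation G X • groupRingSum (Finset.univ : Finset G) := by
  induction X using MonoidAlgebra.induction_linear with
  | zero => simp
  | add X Y hX hY => simp only [add_mul, hX, hY, map_add, add_smul]
  | single g r =>
    ext h
    rw [MonoidAlgebra.coeff_single_mul_apply, coeff_groupRingSum_univ, augmentation_single,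
      MonoidAlgebra.coeff_smul, Finsupp.smul_apply, coeff_groupRingSum_univ]
    simp

/-! ### The multiplier theorem -/

namespace IsDifferenceSet

variable {G : Type*} [CommGroup G] [Fintype G] {D : Finset G} {v k l : ℕ}

theorem sq_eq (hD : IsDifferenceSet D v k l) : (k : ℤ) ^ 2 = l * v + (k - l) := by
  have := congrArg (augmentation G) hD.mul_eq
  rw [map_mul, augmentation_groupRingSum, augmentation_groupRingSumInv, hD.card_set, map_add,
    map_zsmul, map_zsmul, augmentation_groupRingSum, map_one, Finset.card_univ,
    hD.card_group] at this
  simpa [sq] using this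

/-- The coefficients of the product are nonnegative and congruent to `l` modulo `n = p ^ a > l`.
After subtracting `l` they are multiples of `n` exceeding `-n` with sum `k² - l v = n`, so exactly
one is nonzero. -/
theorem powMap_mul_groupRingSumInv (hD : IsDifferenceSet D v k l) {p a : ℕ} (hp : p.Prime)
    (hpv : p.Coprime v) (hk : k = l + p ^ a) (hl : l < p ^ a) :
    ∃ g, powMap G p (groupRingSum D) * groupRingSumInv D =
      (l : ℤ) • groupRingSum (Finset.univ : Finset G) +
        ((k : ℤ) - l) • MonoidAlgebra.single g 1 := by
  classical
  have hcard : Nat.card G = v := by rw [Nat.card_eq_fintype_card, hD.card_group]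
  have hkl : (k : ℤ) - l = (p ^ a : ℕ) := by rw [hk]; push_cast; ring
  have hDU : groupRingSum D * groupRingSum (Finset.univ : Finset G) =
      (k : ℤ) • groupRingSum (Finset.univ : Finset G) := by
    rw [mul_groupRingSum_univ, augmentation_groupRingSum, hD.card_set]
  have haug : augmentation G (powMap G p (groupRingSum D)) = k := by
    simp [groupRingSum, powMap_single, augmentation_single, hD.card_set]
  -- Subtracting `G` from `D⁽⁻¹⁾` changes the coefficient `l` of `G` in the product to `l - k = -p ^
  -- a`.
  have h1 : ((p ^ a : ℕ) : MonoidAlgebra ℤ G) ∣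
      groupRingSum D * (groupRingSumInv D - groupRingSum (Finset.univ : Finset G)) := by
    refine ⟨1 - groupRingSum (Finset.univ : Finset G), ?_⟩
    rw [mul_sub, hD.mul_eq, hDU, hkl, hk]
    push_cast
    simp only [zsmul_eq_mul]
    push_cast
    ring
  have h2 := natCast_dvd_powMap_mul hp (hcard ▸ hpv) a h1
  rw [mul_sub, mul_groupRingSum_univ, haug, MonoidAlgebra.natCast_dvd_iff] at h2
  set F := powMap G p (groupRingSum D) * groupRingSumInv D with hF
  have hnonneg : ∀ x, 0 ≤ F.coeff x := by
    intro x
    have : F = ∑ i ∈ D ×ˢ D, MonoidAlgebra.single (i.1 ^ p * i.2⁻¹) 1 := by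
      rw [hF, groupRingSum, groupRingSumInv, map_sum, Finset.sum_mul_sum, Finset.sum_product]
      simp [powMap_single, MonoidAlgebra.single_mul_single]
    rw [this, MonoidAlgebra.coeff_sum_single]
    positivity
  obtain ⟨g, hg⟩ := exists_eq_ite_of_sum_eq (n := ((p ^ a : ℕ) : ℤ))
    (by exact_mod_cast pow_pos hp.pos a) (fun x => F.coeff x - l)
    (by
      intro x
      have h3 := h2 x
      simp only [MonoidAlgebra.coeff_sub, MonoidAlgebra.coeff_smul, Finsupp.coe_sub, Pi.sub_apply,
        Finsupp.coe_smul, Pi.smul_apply, coeff_groupRingSum_univ] at h3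
      have h4 : F.coeff x - l = (F.coeff x - (k : ℤ) • 1) + (p ^ a : ℕ) := by
        rw [← hkl]; simp
      rw [h4]
      exact dvd_add h3 dvd_rfl)
    (by
      intro x
      have := hnonneg x
      have : (l : ℤ) < (p ^ a : ℕ) := by exact_mod_cast hl
      change _ < F.coeff x - l
      omega)
    (by
      rw [Finset.sum_sub_distrib, ← augmentation_eq_sum, hF, map_mul, haug,
        augmentation_groupRingSumInv, hD.card_set, ← hkl]
      have := hD.sq_eq
      simp only [Finset.sum_const, Finset.card_univ, hD.card_group, nsmul_eq_mul]
      linarith)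
  refine ⟨g, ?_⟩
  ext x
  have h5 := hg x
  rw [hkl]
  simp only [MonoidAlgebra.coeff_add, MonoidAlgebra.coeff_smul, Finsupp.coe_add, Pi.add_apply,
        Finsupp.coe_smul, Pi.smul_apply, coeff_groupRingSum_univ, MonoidAlgebra.coeff_single,
        Finsupp.single_apply]
  simp only [eq_comm (a := g)]
  split_ifs at h5 ⊢ <;> simp <;> push_cast at h5 <;> linarith

/-- Evaluate `D⁽ᵖ⁾ D D⁽⁻¹⁾` in two ways: the multiples of `G` agree, and `n` can be cancelled. -/
theorem powMap_eq (hD : IsDifferenceSet D v k l) {p a : ℕ} (hp : p.Prime)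
    (hpv : p.Coprime v) (hk : k = l + p ^ a) (hl : l < p ^ a) :
    ∃ g, powMap G p (groupRingSum D) = MonoidAlgebra.single g 1 * groupRingSum D := by
  obtain ⟨g, hg⟩ := hD.powMap_mul_groupRingSumInv hp hpv hk hl
  have hkl : (k : ℤ) - l = (p ^ a : ℕ) := by rw [hk]; push_cast; ring
  have hDU : groupRingSum D * groupRingSum (Finset.univ : Finset G) =
      (k : ℤ) • groupRingSum (Finset.univ : Finset G) := by
    rw [mul_groupRingSum_univ, augmentation_groupRingSum, hD.card_set]
  have haug : augmentation G (powMap G p (groupRingSum D)) = k := by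
    simp [groupRingSum, powMap_single, augmentation_single, hD.card_set]
  have hφU : powMap G p (groupRingSum D) * groupRingSum (Finset.univ : Finset G) =
      (k : ℤ) • groupRingSum (Finset.univ : Finset G) := by
    rw [mul_groupRingSum_univ, haug]
  refine ⟨g, MonoidAlgebra.natCast_mul_left_injective (n := p ^ a) (pow_ne_zero _ hp.ne_zero) ?_⟩
  have hm := hD.mul_eq
  rw [hkl] at hm hg
  simp only [zsmul_eq_mul] at hm
  simp only [zsmul_eq_mul] at hg
  simp only [zsmul_eq_mul] at hDU
  simp only [zsmul_eq_mul] at hφU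
  push_cast at hm hg hDU hφU ⊢
  linear_combination (-powMap G p (groupRingSum D)) * hm + groupRingSum D * hg + l * hDU - l * hφU

/-- A prime `p` with `n = pᵃ > l` is a multiplier, and it fixes a normalized difference set. -/
theorem pow_mem (hD : IsDifferenceSet D v k l) (hnorm : IsNormalized D) {p a : ℕ} (hp : p.Prime)
    (hpv : p.Coprime v) (hk : k = l + p ^ a) (hl : l < p ^ a) (hkv : k.Coprime v) :
    ∀ d ∈ D, d ^ p ∈ D := by
  classical
  obtain ⟨g, hg⟩ := hD.powMap_eq hp hpv hk hl
  have hcard : Nat.card G = v := by rw [Nat.card_eq_fintype_card, hD.card_group]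
  have hmem : ∀ d ∈ D, g⁻¹ * d ^ p ∈ D := by
    intro d hd
    have h := congrArg (fun X => X.coeff (d ^ p)) hg
    simp only [groupRingSum, map_sum, powMap_single, Finset.mul_sum,
      MonoidAlgebra.single_mul_single, mul_one] at h
    rw [MonoidAlgebra.coeff_sum_single, MonoidAlgebra.coeff_sum_single] at h
    have hpos : 0 < (D.filter fun i => i ^ p = d ^ p).card :=
      Finset.card_pos.2 ⟨d, by simp [hd]⟩
    rw [Nat.cast_inj] at h
    rw [h] at hpos
    obtain ⟨e, he⟩ := Finset.card_pos.1 hpos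
    rw [Finset.mem_filter] at he
    rw [← he.2, inv_mul_cancel_left]
    exact he.1
  have hinj : Function.Injective fun d : G => d ^ p :=
    (powCoprime (hcard.symm ▸ hpv.symm)).injective
  have himage : D.image (fun d => g⁻¹ * d ^ p) = D := by
    apply Finset.eq_of_subset_of_card_le
    · intro x hx
      obtain ⟨d, hd, rfl⟩ := Finset.mem_image.1 hx
      exact hmem d hd
    · rw [Finset.card_image_of_injective]
      exact (mul_right_injective g⁻¹).comp hinj
  -- Since `D` is normalized this says `g⁻¹ ^ k = 1`, and `k` is prime to `|G|`.
  have hprod : ∏ d ∈ D, (g⁻¹ * d ^ p) = ∏ d ∈ D, d := by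
    conv_rhs => rw [← himage]
    rw [Finset.prod_image]
    exact ((mul_right_injective g⁻¹).comp hinj).injOn
  rw [Finset.prod_mul_distrib, Finset.prod_pow, hnorm, one_pow, mul_one, Finset.prod_const,
    hD.card_set] at hprod
  have hg1 : g⁻¹ = 1 := by
    have h1 := orderOf_dvd_of_pow_eq_one hprod
    have h2 : orderOf g⁻¹ ∣ v := hcard ▸ orderOf_dvd_natCard _
    rw [← orderOf_eq_one_iff]
    exact Nat.eq_one_of_dvd_coprimes hkv h1 h2
  intro d hd
  simpa [hg1] using hmem d hd

end IsDifferenceSet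

/-! ### Subgroups of prescribed order and fibres of quotients -/

theorem Subgroup.card_comap_mk' {G : Type*} [CommGroup G] [Finite G] (K : Subgroup G)
    (L : Subgroup (G ⧸ K)) :
    Nat.card (L.comap (QuotientGroup.mk' K)) = Nat.card K * Nat.card L := by
  have h1 := Subgroup.index_comap_of_surjective L (QuotientGroup.mk'_surjective K)
  have h2 := (L.comap (QuotientGroup.mk' K)).card_mul_index
  have h3 := L.card_mul_index
  have h4 := K.card_mul_index
  rw [h1] at h2
  have h5 : Nat.card (G ⧸ K) = K.index := rfl
  have h6 : 0 < L.index := Nat.pos_of_ne_zero L.index_ne_zero_of_finite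
  apply Nat.eq_of_mul_eq_mul_right h6
  rw [h2, ← h4, ← h5, ← h3, mul_assoc]

theorem CommGroup.exists_subgroup_card_eq {G : Type*} [CommGroup G] [Finite G] {d : ℕ}
    (hd : d ∣ Nat.card G) : ∃ H : Subgroup G, Nat.card H = d := by
  induction d using Nat.strong_induction_on generalizing G with
  | _ d ih =>
    have hd0 : 0 < d := Nat.pos_of_dvd_of_pos hd Nat.card_pos
    rcases eq_or_ne d 1 with rfl | hd1
    · exact ⟨⊥, Subgroup.card_bot⟩
    · have hp := Nat.minFac_prime hd1
      have := Fact.mk hp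
      obtain ⟨x, hx⟩ := exists_prime_orderOf_dvd_card' (G := G) d.minFac
        ((Nat.minFac_dvd d).trans hd)
      obtain ⟨e, he⟩ := Nat.minFac_dvd d
      have hcard := (Subgroup.zpowers x).card_mul_index
      rw [Nat.card_zpowers, hx] at hcard
      have he' : e ∣ Nat.card (G ⧸ Subgroup.zpowers x) := by
        apply Nat.dvd_of_mul_dvd_mul_left hp.pos
        rw [← he]
        exact hcard.symm ▸ hd
      have he0 : 0 < e := Nat.pos_of_ne_zero fun h => by simp [h] at he; omega
      obtain ⟨L, hL⟩ := ih e (by nlinarith [hp.two_le]) he'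
      refine ⟨L.comap (QuotientGroup.mk' _), ?_⟩
      rw [Subgroup.card_comap_mk', hL, Nat.card_zpowers, hx, ← he]

theorem Subgroup.exists_le_card_eq {G : Type*} [CommGroup G] [Finite G] (K : Subgroup G) {d : ℕ}
    (hK : Nat.card K ∣ d) (hd : d ∣ Nat.card G) : ∃ L, K ≤ L ∧ Nat.card L = d := by
  obtain ⟨e, rfl⟩ := hK
  have he : e ∣ Nat.card (G ⧸ K) := by
    apply Nat.dvd_of_mul_dvd_mul_left (Nat.card_pos (α := K))
    exact (K.card_mul_index).symm ▸ hd
  obtain ⟨L, hL⟩ := CommGroup.exists_subgroup_card_eq he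
  refine ⟨L.comap (QuotientGroup.mk' K), fun x hx => ?_, ?_⟩
  · rw [Subgroup.mem_comap, QuotientGroup.mk'_apply, (QuotientGroup.eq_one_iff x).2 hx]
    exact L.one_mem
  · rw [Subgroup.card_comap_mk', hL]

theorem QuotientGroup.card_filter_mk_eq {G : Type*} [CommGroup G] [Fintype G] (H : Subgroup G)
    [DecidableEq (G ⧸ H)] (x : G ⧸ H) :
    (Finset.univ.filter fun g : G => (g : G ⧸ H) = x).card = Nat.card H := by
  induction x using QuotientGroup.induction_on with
  | H a =>
    classical
    rw [Nat.card_eq_fintype_card, ← Finset.card_univ]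
    symm
    refine Finset.card_bij (fun h _ => a * h) (fun h _ => ?_) (fun h _ h' _ e => ?_)
      (fun g hg => ?_)
    · simp
    · exact Subtype.ext (mul_left_cancel e)
    · rw [Finset.mem_filter] at hg
      exact ⟨⟨a⁻¹ * g, QuotientGroup.eq.1 hg.2.symm⟩, Finset.mem_univ _, by simp⟩

theorem groupRingSum_image {G : Type*} [CommGroup G] (D : Finset G) {t : ℕ}
    (hinj : Function.Injective fun d : G => d ^ t) (hD : ∀ d ∈ D, d ^ t ∈ D) :
    powMap G t (groupRingSum D) = groupRingSum D := by
  classical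
  have himage : D.image (fun d => d ^ t) = D := by
    apply Finset.eq_of_subset_of_card_le
    · intro x hx
      obtain ⟨d, hd, rfl⟩ := Finset.mem_image.1 hx
      exact hD d hd
    · rw [Finset.card_image_of_injective _ hinj]
  simp only [groupRingSum, map_sum, powMap_single]
  conv_rhs => rw [← himage]
  rw [Finset.sum_image hinj.injOn]

/-! ### The image of `D` in `G/H` -/

namespace IsDifferenceSet

variable {G : Type*} [CommGroup G] [Fintype G] {D : Finset G}

theorem exists_coset_card_filter {p e : ℕ} (hp : p.Prime) (he : 0 < e)
    (hD : IsDifferenceSet D ((p ^ e + 1) * ((p ^ e) ^ 2 + 1)) ((p ^ e) ^ 2 + p ^ e + 1) (p ^ e + 1))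
    (hpow : powMap G ((p ^ e) ^ 2) (groupRingSum D) = groupRingSum D)
    (H : Subgroup G) (hH : Nat.card H = p ^ e + 1) [DecidableEq (G ⧸ H)] :
    ∃ c : G ⧸ H, c * c = 1 ∧ ∀ x : G ⧸ H,
      (D.filter fun d : G => (d : G ⧸ H) = x).card = if x = c then p ^ e + 1 else 1 := by
  have : Fintype (G ⧸ H) := Fintype.ofFinite _
  set Q := p ^ e with hQ
  have hQ2 : 2 ≤ Q := hp.two_le.trans (Nat.le_self_pow he.ne' p)
  have hΓ : Nat.card (G ⧸ H) = Q ^ 2 + 1 := by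
    have h := H.card_mul_index
    rw [hH, Nat.card_eq_fintype_card, hD.card_group] at h
    exact Nat.eq_of_mul_eq_mul_left (Nat.succ_pos Q) h
  have hcop : p.Coprime (Nat.card (G ⧸ H)) := by
    rw [hΓ, ← Nat.coprime_pow_left_iff (Nat.pos_of_ne_zero he.ne') p, ← hQ, sq]
    simp
  -- `Q² ≡ -1` modulo `|G/H|`; hence `A` will equal the image of `D⁽⁻¹⁾`.
  have hinv : ∀ x : G ⧸ H, x ^ Q ^ 2 = x⁻¹ := by
    intro x
    rw [eq_inv_iff_mul_eq_one, ← pow_succ, ← hΓ, pow_card_eq_one']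
  set π : MonoidAlgebra ℤ G →+* MonoidAlgebra ℤ (G ⧸ H) :=
    MonoidAlgebra.mapDomainRingHom ℤ (QuotientGroup.mk' H) with hπ
  have hπs : ∀ (g : G) (r : ℤ), π (MonoidAlgebra.single g r) =
      MonoidAlgebra.single (g : G ⧸ H) r := by
    intro g r; simp [hπ]
  set A := π (groupRingSum D) with hA
  have hAsum : A = ∑ d ∈ D, MonoidAlgebra.single (d : G ⧸ H) 1 := by
    simp [hA, groupRingSum, hπs]
  have hAcoeff : ∀ x, A.coeff x = ((D.filter fun d : G => (d : G ⧸ H) = x).card : ℤ) := by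
    intro x; rw [hAsum, MonoidAlgebra.coeff_sum_single]
  have hAinv : A = ∑ d ∈ D, MonoidAlgebra.single (d : G ⧸ H)⁻¹ 1 := by
    rw [hA, ← hpow]
    simp [groupRingSum, powMap_single, hπs, hinv]
  have hAinv' : π (groupRingSumInv D) = A := by
    rw [hAinv]; simp [groupRingSumInv, hπs]
  set U := groupRingSum (Finset.univ : Finset (G ⧸ H)) with hU
  have hπU : π (groupRingSum (Finset.univ : Finset G)) =
      ((Q + 1 : ℕ) : MonoidAlgebra ℤ (G ⧸ H)) * U := by
    ext x
    rw [MonoidAlgebra.coeff_natCast_mul, coeff_groupRingSum_univ, groupRingSum, map_sum]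
    simp only [hπs]
    rw [MonoidAlgebra.coeff_sum_single, QuotientGroup.card_filter_mk_eq, hH, mul_one]
  have hAU : A * U = ((Q ^ 2 + Q + 1 : ℕ) : MonoidAlgebra ℤ (G ⧸ H)) * U := by
    rw [mul_groupRingSum_univ, hAsum, map_sum, hU]
    simp [augmentation_single, hD.card_set]
  have hUU : U * U = ((Q ^ 2 + 1 : ℕ) : MonoidAlgebra ℤ (G ⧸ H)) * U := by
    rw [mul_groupRingSum_univ, hU, augmentation_groupRingSum, Finset.card_univ,
      ← Nat.card_eq_fintype_card, hΓ]
    simp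
  have hAA : A * A = ((Q + 1 : ℕ) : MonoidAlgebra ℤ (G ⧸ H)) *
      (((Q + 1 : ℕ) : MonoidAlgebra ℤ (G ⧸ H)) * U) +
      ((Q ^ 2 : ℕ) : MonoidAlgebra ℤ (G ⧸ H)) := by
    have h := congrArg π hD.mul_eq
    rw [map_mul, hAinv', map_add, map_zsmul, map_zsmul, hπU, map_one] at h
    rw [hA, h]
    simp only [zsmul_eq_mul]
    push_cast
    ring
  have hBB : (A - U) ^ 2 = ((p ^ (2 * e) : ℕ) : MonoidAlgebra ℤ (G ⧸ H)) := by
    have : p ^ (2 * e) = Q ^ 2 := by rw [hQ, ← pow_mul, mul_comm]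
    rw [this]
    push_cast at *
    linear_combination hAA - 2 * hAU + hUU
  have hdvd := natCast_dvd_of_dvd_sq hp hcop e (X := A - U) (by rw [hBB])
  rw [← hQ, MonoidAlgebra.natCast_dvd_iff] at hdvd
  have hBcoeff : ∀ x, (A - U).coeff x = A.coeff x - 1 := by
    intro x
    rw [MonoidAlgebra.coeff_sub, Finsupp.sub_apply, coeff_groupRingSum_univ]
  obtain ⟨c, hc⟩ := exists_eq_ite_of_sum_eq (n := (Q : ℤ)) (by positivity) _ hdvd
    (by
      intro x
      rw [hBcoeff, hAcoeff]
      have : (2 : ℤ) ≤ Q := by exact_mod_cast hQ2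
      have : (0 : ℤ) ≤ ((D.filter fun d : G => (d : G ⧸ H) = x).card : ℤ) := by positivity
      omega)
    (by
      rw [← augmentation_eq_sum, map_sub, hU, augmentation_groupRingSum, Finset.card_univ,
        ← Nat.card_eq_fintype_card, hΓ, hAsum, map_sum]
      simp [augmentation_single, hD.card_set])
  have hcard : ∀ x : G ⧸ H,
      (D.filter fun d : G => (d : G ⧸ H) = x).card = if x = c then Q + 1 else 1 := by
    intro x
    have h := hc x
    rw [hBcoeff, hAcoeff] at h
    split_ifs at h ⊢ <;> omega
  refine ⟨c, ?_, hcard⟩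
  -- `A` is invariant under inversion and `c` is the only coset with coefficient `Q + 1`, so `c⁻¹ =
  -- c`.
  have h1 : A.coeff c⁻¹ = A.coeff c := by
    conv_lhs => rw [hAinv]
    rw [hAcoeff, MonoidAlgebra.coeff_sum_single]
    simp only [inv_inj]
  rw [hAcoeff, hAcoeff, hcard c, if_pos rfl, hcard] at h1
  by_contra hcc
  rw [if_neg] at h1
  · push_cast at h1; omega
  · intro h
    apply hcc
    rw [← eq_inv_iff_mul_eq_one, h]

end IsDifferenceSet

/-! ### Groups of order twice an odd number -/

theorem Subgroup.prod_mem_iff_even_card_filter {G : Type*} [CommGroup G] (K : Subgroup G)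
    [DecidablePred (· ∈ K)] (hK : K.index = 2) (S : Finset G) :
    ∏ x ∈ S, x ∈ K ↔ Even (S.filter fun x => x ∉ K).card := by
  classical
  induction S using Finset.induction_on with
  | empty => simp [K.one_mem]
  | insert a S ha ih =>
    rw [Finset.prod_insert ha, Subgroup.mul_mem_iff_of_index_two hK, ih, Finset.filter_insert]
    split_ifs with h
    · tauto
    · rw [Finset.card_insert_of_notMem (by simp [ha]), Nat.even_add_one]
      tauto

/-- The complement of `K` has `|K|` elements, an odd number. -/
theorem Subgroup.prod_univ_notMem {G : Type*} [CommGroup G] [Fintype G] (K : Subgroup G)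
    (hK : K.index = 2) (hodd : Odd (Nat.card K)) : ∏ x : G, x ∉ K := by
  classical
  rw [K.prod_mem_iff_even_card_filter hK, Nat.not_even_iff_odd]
  have h1 : (Finset.univ.filter fun x => x ∈ K).card = Nat.card K := by
    rw [Nat.card_eq_fintype_card, Fintype.card_subtype]
  have h2 := Finset.card_filter_add_card_filter_not (s := (Finset.univ : Finset G)) (· ∈ K)
  have h3 := K.card_mul_index
  rw [hK, Nat.card_eq_fintype_card (α := G), ← Finset.card_univ, ← h2, h1] at h3
  have h4 : (Finset.univ.filter fun x => x ∉ K).card = Nat.card K := by omega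
  rwa [h4]

theorem Subgroup.eq_one_of_pow_two_pow_eq_one {G : Type*} [Group G] {K : Subgroup G}
    (hodd : Odd (Nat.card K)) {x : G} (hx : x ∈ K) {j : ℕ} (hj : x ^ 2 ^ j = 1) : x = 1 := by
  rw [← orderOf_eq_one_iff]
  refine Nat.eq_one_of_dvd_coprimes (a := 2 ^ j) (b := Nat.card K) ?_
    (orderOf_dvd_of_pow_eq_one hj) (K.orderOf_dvd_natCard hx)
  exact Nat.Coprime.pow_left _ (Nat.coprime_two_left.2 hodd)

/-- Nontrivial 2-elements avoid the odd subgroup `K` of index 2; the product of two of them is a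
2-element of `K`, hence trivial. -/
theorem CommGroup.eq_of_card_eq_two_mul_odd {G : Type*} [CommGroup G] [Finite G] {w : ℕ}
    (hw : Odd w) (hG : Nat.card G = 2 * w) {x y : G} (hx1 : x ≠ 1) (hx : x * x = 1) (hy1 : y ≠ 1)
    {j : ℕ} (hy : y ^ 2 ^ j = 1) : y = x := by
  obtain ⟨K, hK⟩ := CommGroup.exists_subgroup_card_eq (G := G) (d := w) (hG ▸ dvd_mul_left _ _)
  have hindex : K.index = 2 := by
    have := K.card_mul_index
    rw [hK, hG, mul_comm 2] at this
    exact Nat.eq_of_mul_eq_mul_left hw.pos this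
  rw [← hK] at hw
  have hx' : x ∉ K := fun h =>
    hx1 (Subgroup.eq_one_of_pow_two_pow_eq_one hw h (j := 1) (by rw [pow_one, sq, hx]))
  have hy' : y ∉ K := fun h => hy1 (Subgroup.eq_one_of_pow_two_pow_eq_one hw h hy)
  have hxy : y * x ∈ K := by
    rw [Subgroup.mul_mem_iff_of_index_two hindex]; tauto
  have := Subgroup.eq_one_of_pow_two_pow_eq_one hw hxy (j := j + 1) (by
    rw [mul_pow, pow_succ 2 j, pow_mul, hy, mul_comm (2 ^ j) 2, pow_mul, sq x, hx]
    simp)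
  rw [mul_eq_one_iff_eq_inv] at this
  rw [this, inv_eq_iff_mul_eq_one, hx]

/-! ### The exceptional coset and the uniqueness of `H` -/

namespace IsDifferenceSet

variable {G : Type*} [CommGroup G] [Fintype G] {D : Finset G}

/-- A normalized difference set with the parameters of the hyperplanes of `PG(3, Q)` contains one
coset of a subgroup of order `Q + 1` and meets the others in a single element. -/
theorem exists_coset {p e : ℕ} (hp : p.Prime) (he : 0 < e)
    (hD : IsDifferenceSet D ((p ^ e + 1) * ((p ^ e) ^ 2 + 1)) ((p ^ e) ^ 2 + p ^ e + 1) (p ^ e + 1))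
    (hnorm : IsNormalized D)
    (hpow : powMap G ((p ^ e) ^ 2) (groupRingSum D) = groupRingSum D)
    (H : Subgroup G) (hH : Nat.card H = p ^ e + 1) :
    ∃ c : G ⧸ H, c * c = 1 ∧ (c = 1 ↔ Even (p ^ e)) ∧ (∀ g : G, (g : G ⧸ H) = c → g ∈ D) ∧
      ∀ g : G, (g : G ⧸ H) ≠ c → ∃! d : G, d ∈ D ∧ (d : G ⧸ H) = g := by
  classical
  obtain ⟨c, hcc, hc⟩ := hD.exists_coset_card_filter hp he hpow H hH
  have : Fintype (G ⧸ H) := Fintype.ofFinite _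
  have hΓ : Nat.card (G ⧸ H) = (p ^ e) ^ 2 + 1 := by
    have h := H.card_mul_index
    rw [hH, Nat.card_eq_fintype_card, hD.card_group] at h
    exact Nat.eq_of_mul_eq_mul_left (Nat.succ_pos (p ^ e)) h
  set Q := p ^ e with hQ
  -- Modulo `H` the normalized product counts `c` with multiplicity `Q + 1` and every other coset
  -- once.
  have hprod : c ^ Q * ∏ x : G ⧸ H, x = 1 := by
    have h1 : ∏ d ∈ D, (d : G ⧸ H) = 1 := by
      have := congrArg (QuotientGroup.mk' H) hnorm
      rw [map_prod, map_one] at this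
      exact this
    rw [← Finset.prod_fiberwise D (fun d : G => (d : G ⧸ H))] at h1
    rw [← h1]
    have h2 : ∀ x : G ⧸ H, ∏ d ∈ D.filter (fun d : G => (d : G ⧸ H) = x), (d : G ⧸ H) =
        (if x = c then c ^ Q else 1) * x := by
      intro x
      rw [Finset.prod_congr rfl (fun d hd => (Finset.mem_filter.1 hd).2), Finset.prod_const, hc x]
      split_ifs with h
      · rw [h, pow_succ]
      · simp
    rw [Finset.prod_congr rfl fun x _ => h2 x, Finset.prod_mul_distrib]
    simp
  refine ⟨c, hcc, ⟨?_, ?_⟩, ?_, ?_⟩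
  · rintro rfl
    by_contra hodd
    rw [Nat.not_even_iff_odd] at hodd
    obtain ⟨t, ht⟩ := hodd
    -- For odd `Q` the order of `G/H` is twice an odd number, so the product of its elements is
    -- nontrivial, contradicting `hprod` at `c = 1`.
    obtain ⟨w, hw, hw'⟩ : ∃ w, Odd w ∧ Q ^ 2 + 1 = 2 * w :=
      ⟨2 * (t ^ 2 + t) + 1, ⟨_, rfl⟩, by rw [ht]; ring⟩
    obtain ⟨K, hK⟩ := CommGroup.exists_subgroup_card_eq (G := G ⧸ H) (d := w)
      (by rw [hΓ, hw']; exact dvd_mul_left _ _)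
    have hindex : K.index = 2 := by
      have := K.card_mul_index
      rw [hK, hΓ, hw', mul_comm 2] at this
      exact Nat.eq_of_mul_eq_mul_left hw.pos this
    refine K.prod_univ_notMem hindex (hK ▸ hw) ?_
    rw [one_pow, one_mul] at hprod
    rw [hprod]
    exact K.one_mem
  · intro heven
    refine Subgroup.eq_one_of_pow_two_pow_eq_one (K := ⊤) ?_ (Subgroup.mem_top c) (j := 1)
      (by rw [pow_one, sq, hcc])
    rw [Subgroup.card_top, hΓ]
    exact (heven.pow_of_ne_zero two_ne_zero).add_one
  · intro g hg
    have h1 : D.filter (fun d : G => (d : G ⧸ H) = c) =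
        Finset.univ.filter (fun d : G => (d : G ⧸ H) = c) := by
      apply Finset.eq_of_subset_of_card_le
      · exact Finset.filter_subset_filter _ (Finset.subset_univ _)
      · rw [hc, if_pos rfl, QuotientGroup.card_filter_mk_eq, hH]
    have : g ∈ D.filter (fun d : G => (d : G ⧸ H) = c) := by simp [h1, hg]
    exact (Finset.mem_filter.1 this).1
  · intro g hg
    have h1 := hc g
    rw [if_neg hg, Finset.card_eq_one] at h1
    obtain ⟨d, hd⟩ := h1
    have h2 : ∀ x : G, (x ∈ D ∧ (x : G ⧸ H) = g) ↔ x = d := by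
      intro x
      simpa using Finset.ext_iff.1 hd x
    exact ⟨d, (h2 d).2 rfl, fun y hy => (h2 y).1 hy⟩

/-- `H` and `K` share some `y ≠ 1`. For `x` in the coset of `H` inside `D`, both `x` and `xy` are
elements of `D` in one coset of `K`, which must be the exceptional one. So that coset of `H` lies in
a coset of `K`. -/
theorem eq_of_card_eq {p e : ℕ} (hp : p.Prime) (he : 0 < e)
    (hD : IsDifferenceSet D ((p ^ e + 1) * ((p ^ e) ^ 2 + 1)) ((p ^ e) ^ 2 + p ^ e + 1) (p ^ e + 1))
    (hnorm : IsNormalized D)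
    (hpow : powMap G ((p ^ e) ^ 2) (groupRingSum D) = groupRingSum D)
    {H K : Subgroup G} (hH : Nat.card H = p ^ e + 1) (hK : Nat.card K = p ^ e + 1) : H = K := by
  obtain ⟨c, -, -, hcD, -⟩ := hD.exists_coset hp he hnorm hpow H hH
  obtain ⟨c', -, -, -, hc'⟩ := hD.exists_coset hp he hnorm hpow K hK
  have hQ2 : 2 ≤ p ^ e := hp.two_le.trans (Nat.le_self_pow he.ne' p)
  obtain ⟨y, hyH, hyK, hy1⟩ : ∃ y ∈ H, y ∈ K ∧ y ≠ 1 := by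
    by_contra! h
    have hinj : Function.Injective ((QuotientGroup.mk' K).comp H.subtype) := by
      rw [injective_iff_map_eq_one]
      intro a ha
      have : (a : G) ∈ K := (QuotientGroup.eq_one_iff _).1 ha
      exact Subtype.ext (h a a.2 this)
    have h1 := Subgroup.card_dvd_of_injective _ hinj
    have h2 := K.card_mul_index
    rw [hK, Nat.card_eq_fintype_card, hD.card_group] at h2
    have h3 : Nat.card (G ⧸ K) = (p ^ e) ^ 2 + 1 :=
      Nat.eq_of_mul_eq_mul_left (Nat.succ_pos (p ^ e)) h2
    rw [hH, h3] at h1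
    obtain ⟨r, hr⟩ : ∃ r, p ^ e = r + 1 := ⟨p ^ e - 1, by omega⟩
    rw [hr] at h1 hQ2
    -- `Q² + 1 = (Q + 1)(Q - 1) + 2`, so a trivial intersection would give `Q + 1 ∣ 2`.
    have h4 : (r + 1) ^ 2 + 1 = (r + 1 + 1) * r + 2 := by ring
    rw [h4] at h1
    have h5 := (Nat.dvd_add_right (dvd_mul_right _ _)).1 h1
    have := Nat.le_of_dvd two_pos h5
    omega
  obtain ⟨g, rfl⟩ := QuotientGroup.mk_surjective c
  have hmem : ∀ x : G, (x : G ⧸ H) = g → (x : G ⧸ K) = c' := by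
    intro x hx
    by_contra hne
    obtain ⟨d, -, hd⟩ := hc' x hne
    have h1 := hd x ⟨hcD x hx, rfl⟩
    have h2 := hd (x * y) ⟨hcD _ ?_, ?_⟩
    · rw [← h1, mul_eq_left] at h2
      exact hy1 h2
    · rw [← hx, eq_comm, QuotientGroup.eq]; simpa
    · rw [eq_comm, QuotientGroup.eq]; simpa
  have hle : H ≤ K := by
    intro h hh
    have h1 := hmem (g * h) (by rw [eq_comm, QuotientGroup.eq]; simpa)
    rw [← hmem g rfl, eq_comm, QuotientGroup.eq] at h1
    simpa using h1
  exact Subgroup.eq_of_le_of_card_ge hle (by rw [hH, hK])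

end IsDifferenceSet

/-! ### Membership in a subgroup from the order of an element -/

/-- In a cyclic group the kernel of `x ↦ x ^ |K|` has at most `|K|` elements, and it contains `K`.
-/
theorem Subgroup.mem_of_pow_card_eq_one_of_isCyclic {G : Type*} [CommGroup G] [Finite G]
    {C K : Subgroup G} (hC : IsCyclic C) (hKC : K ≤ C) {y : G} (hy : y ∈ C)
    (hpow : y ^ Nat.card K = 1) : y ∈ K := by
  have hle : K.subgroupOf C ≤ (powMonoidHom (Nat.card K) : C →* C).ker := by
    intro x hx
    rw [MonoidHom.mem_ker, powMonoidHom_apply]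
    exact Subtype.ext (orderOf_dvd_iff_pow_eq_one.1 (K.orderOf_dvd_natCard (Subgroup.mem_subgroupOf.1 hx)))
  have hcard : Nat.card (K.subgroupOf C) = Nat.card K :=
    Nat.card_congr (Subgroup.subgroupOfEquivOfLe hKC).toEquiv
  have heq := Subgroup.eq_of_le_of_card_ge hle (by
    rw [IsCyclic.card_powMonoidHom_ker, hcard]
    exact Nat.gcd_le_right _ Nat.card_pos)
  have : (⟨y, hy⟩ : C) ∈ K.subgroupOf C := by
    rw [heq, MonoidHom.mem_ker, powMonoidHom_apply]
    exact Subtype.ext hpow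
  exact Subgroup.mem_subgroupOf.1 this

theorem Subgroup.mem_of_pow_eq_one_of_coprime_index {G : Type*} [CommGroup G] [Finite G]
    (M : Subgroup G) {y : G} {n : ℕ} (hy : y ^ n = 1) (hn : n.Coprime M.index) : y ∈ M := by
  rw [← QuotientGroup.eq_one_iff, ← orderOf_eq_one_iff]
  refine Nat.eq_one_of_dvd_coprimes hn (orderOf_dvd_of_pow_eq_one ?_)
    (_root_.orderOf_dvd_natCard _)
  rw [← QuotientGroup.mk_pow, hy, QuotientGroup.mk_one]

/-- If the Sylow `r`-subgroups are cyclic, a subgroup contains all elements of `r`-power order dividing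
its own order. -/
theorem Subgroup.mem_of_isCyclic_sylow {G : Type*} [CommGroup G] [Finite G] {r : ℕ}
    (hr : r.Prime) (hcyc : ∀ P : Sylow r G, IsCyclic P) (M : Subgroup G) {y : G} {j : ℕ}
    (hy : y ^ r ^ j = 1) (hj : r ^ j ∣ Nat.card M) : y ∈ M := by
  have := Fact.mk hr
  obtain ⟨K', hK'⟩ := CommGroup.exists_subgroup_card_eq hj
  set K := K'.map M.subtype with hK
  have hKM : K ≤ M := Subgroup.map_subtype_le K'
  have hKcard : Nat.card K = r ^ j := by
    rw [← hK']
    exact (Nat.card_congr (K'.equivMapOfInjective _ M.subtype_injective).toEquiv).symm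
  have hKp : IsPGroup r K := IsPGroup.of_card hKcard
  obtain ⟨i, -, hi⟩ := (Nat.dvd_prime_pow hr).1 (orderOf_dvd_of_pow_eq_one hy)
  have hyp : IsPGroup r (Subgroup.zpowers y) := IsPGroup.of_card (by rw [Nat.card_zpowers, hi])
  obtain ⟨P, hP⟩ := (hKp.to_sup_of_normal_right hyp).exists_le_sylow
  exact hKM (Subgroup.mem_of_pow_card_eq_one_of_isCyclic (hcyc P) (le_sup_left.trans hP)
    (hP (Subgroup.mem_sup_right (Subgroup.mem_zpowers y))) (by rw [hKcard, hy]))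

/-- Bézout writes an element of order `ab`, with `a`, `b` coprime, through its `a`-th and `b`-th
powers. -/
theorem Subgroup.mem_of_forall_prime_pow {G : Type*} [CommGroup G] [Finite G] (M : Subgroup G)
    {m : ℕ} (h : ∀ (y : G) (r j : ℕ), r.Prime → 0 < j → orderOf y = r ^ j → r ^ j ∣ m → y ∈ M)
    {x : G} (hx : x ^ m = 1) : x ∈ M := by
  have key : ∀ n, ∀ y : G, orderOf y = n → n ∣ m → y ∈ M := by
    intro n
    induction n using Nat.recOnPosPrimePosCoprime with
    | prime_pow r j hr hj => exact fun y hy hd => h y r j hr hj hy hd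
    | zero => exact fun y hy => absurd hy (orderOf_pos y).ne'
    | one =>
      intro y hy _
      rw [orderOf_eq_one_iff.1 hy]
      exact M.one_mem
    | coprime a b ha hb hab iha ihb =>
      intro y hy hd
      have h1 : y ^ a ∈ M := by
        refine ihb _ ?_ (dvd_trans (dvd_mul_left _ _) hd)
        rw [orderOf_pow_of_dvd (by omega) (hy ▸ dvd_mul_right _ _), hy,
          Nat.mul_div_cancel_left _ (by omega)]
      have h2 : y ^ b ∈ M := by
        refine iha _ ?_ (dvd_trans (dvd_mul_right _ _) hd)
        rw [orderOf_pow_of_dvd (by omega) (hy ▸ dvd_mul_left _ _), hy,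
          Nat.mul_div_cancel _ (by omega)]
      have h3 : y = (y ^ a) ^ (Nat.gcdA a b) * (y ^ b) ^ (Nat.gcdB a b) := by
        rw [← zpow_natCast, ← zpow_natCast, ← zpow_mul, ← zpow_mul, ← zpow_add,
          ← Nat.gcd_eq_gcd_ab, hab, Nat.cast_one, zpow_one]
      rw [h3]
      exact M.mul_mem (M.zpow_mem h1 _) (M.zpow_mem h2 _)
  exact key _ x rfl (orderOf_dvd_of_pow_eq_one hx)

/-! ### Arithmetic of `qˢ + 1` and `q²ˢ + 1` -/

/-- Since `x ≡ -1` modulo `x + 1`, the quotient `u = xˢ⁻¹ - xˢ⁻² + ⋯ + 1` is congruent to `s`. -/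
theorem Odd.exists_pow_add_one_eq_mul {s : ℕ} (hs : Odd s) (x : ℕ) :
    ∃ u, x ^ s + 1 = (x + 1) * u ∧ ∀ r, r ∣ u → r ∣ x + 1 → r ∣ s := by
  obtain ⟨u, hu⟩ : x + 1 ∣ x ^ s + 1 := by simpa using hs.nat_add_dvd_pow_add_pow x 1
  refine ⟨u, hu, fun r hr hrx => ?_⟩
  obtain ⟨t, rfl⟩ := hs
  obtain ⟨w, hw, hws⟩ : ∃ w : ℤ, (x : ℤ) ^ (2 * t + 1) + 1 = (x + 1) * w ∧
      (x + 1 : ℤ) ∣ w - (2 * t + 1 : ℕ) := by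
    clear hu hr hrx
    induction t with
    | zero => exact ⟨1, by ring, by simp⟩
    | succ t ih =>
      obtain ⟨w, hw, c, hc⟩ := ih
      -- From `x²ᵗ⁺³ + 1 = x²(x²ᵗ⁺¹ + 1) - (x² - 1)`.
      refine ⟨x ^ 2 * w - (x - 1), ?_, c + (x - 1) * w - 1, ?_⟩
      · linear_combination (x : ℤ) ^ 2 * hw
      · push_cast at hc ⊢
        linear_combination hc
  have hwu : w = u := by
    have h1 : ((x : ℤ) + 1) * w = (x + 1) * u := by rw [← hw]; exact_mod_cast hu
    exact mul_left_cancel₀ (by positivity) h1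
  rw [hwu] at hws
  have h1 : (r : ℤ) ∣ (x + 1 : ℤ) := by exact_mod_cast hrx
  have h2 : (r : ℤ) ∣ u := by exact_mod_cast hr
  have h3 := (dvd_sub_right h2).1 (h1.trans hws)
  exact_mod_cast h3

theorem Nat.Prime.eq_two_of_dvd_add_one_of_dvd_sq_add_one {r x : ℕ} (hr : r.Prime)
    (h1 : r ∣ x + 1) (h2 : r ∣ x ^ 2 + 1) : r = 2 := by
  rw [← Nat.prime_dvd_prime_iff_eq hr Nat.prime_two]
  zify at h1 h2 ⊢
  have : (2 : ℤ) = (x ^ 2 + 1) - (x + 1) * (x - 1) := by ring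
  rw [this]
  exact _root_.dvd_sub h2 (h1.mul_right _)

/-- The arithmetic of the factorization `(qˢ + 1)(q²ˢ + 1) = (q + 1)(q² + 1) u v` for odd `s`. -/
theorem exists_cofactors {q s : ℕ} (hs : Odd s) :
    ∃ u v, q ^ s + 1 = (q + 1) * u ∧ q ^ (2 * s) + 1 = (q ^ 2 + 1) * v ∧ Odd u ∧ Odd v ∧
      ∀ r : ℕ, r.Prime → r ∣ u * v → r ∣ (q + 1) * (q ^ 2 + 1) →
        r ∣ Nat.gcd (q + 1) s ∨ r ∣ Nat.gcd (q ^ 2 + 1) s := by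
  obtain ⟨u, hu, hus⟩ := hs.exists_pow_add_one_eq_mul q
  obtain ⟨v, hv, hvs⟩ := hs.exists_pow_add_one_eq_mul (q ^ 2)
  -- If `w` is even then `x ^ s + 1` is even, so `x` is odd; then 2 divides both `w` and `x + 1`,
  -- hence the odd number `s`.
  have hodd : ∀ x w : ℕ, x ^ s + 1 = (x + 1) * w → (∀ r, r ∣ w → r ∣ x + 1 → r ∣ s) → Odd w := by
    intro x w hw hws
    by_contra h
    rw [Nat.not_odd_iff_even] at h
    have h1 : ¬ 2 ∣ x + 1 := fun h2 => by
      have := hws 2 h.two_dvd h2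
      obtain ⟨t, rfl⟩ := hs
      omega
    have h3 : Even (x ^ s + 1) := hw ▸ h.mul_left _
    rw [Nat.even_add_one, Nat.even_pow' hs.pos.ne'] at h3
    rw [← even_iff_two_dvd, Nat.even_add_one] at h1
    exact h1 h3
  have hu2 := hodd q u hu hus
  have hv2 := hodd (q ^ 2) v hv hvs
  have hq2 : q ^ (2 * s) = (q ^ s) ^ 2 := by rw [← pow_mul, mul_comm]
  refine ⟨u, v, hu, by rw [pow_mul, hv], hu2, hv2, fun r hr h1 h2 => ?_⟩
  have hr2 : r ≠ 2 := by
    rintro rfl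
    exact (Nat.not_even_iff_odd.2 (hu2.mul hv2)) (even_iff_two_dvd.2 h1)
  rw [← pow_mul, hq2] at hv
  -- In the mixed cases `r` divides both `Q + 1` and `Q² + 1`, where `Q = q ^ s`, which forces `r =
  -- 2`.
  rcases hr.dvd_mul.1 h1 with h1 | h1 <;> rcases hr.dvd_mul.1 h2 with h2 | h2
  · exact Or.inl (Nat.dvd_gcd h2 (hus r h1 h2))
  · exact absurd (hr.eq_two_of_dvd_add_one_of_dvd_sq_add_one (x := q ^ s)
      (hu ▸ h1.mul_left _) (hv ▸ h2.mul_right _)) hr2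
  · exact absurd (hr.eq_two_of_dvd_add_one_of_dvd_sq_add_one (x := q ^ s)
      (hu ▸ h2.mul_right _) (hv ▸ h1.mul_left _)) hr2
  · exact Or.inr (Nat.dvd_gcd h2 (hvs r h1 h2))

/-- If `q ≡ 1` modulo `r`, the product is congruent to 4. -/
theorem Nat.Prime.eq_two_of_dvd_sub_one {r q s : ℕ} (hr : r.Prime) (hq : 1 ≤ q)
    (h1 : r ∣ (q ^ s + 1) * (q ^ (2 * s) + 1)) (h2 : r ∣ q - 1) : r = 2 := by
  have hq1 : q ≡ 1 [MOD r] := ((Nat.modEq_iff_dvd' hq).2 h2).symm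
  have h3 : (q ^ s + 1) * (q ^ (2 * s) + 1) ≡ (1 ^ s + 1) * (1 ^ (2 * s) + 1) [MOD r] :=
    ((hq1.pow s).add_right 1).mul ((hq1.pow (2 * s)).add_right 1)
  have h4 : r ∣ 2 ^ 2 := by
    have := (Nat.modEq_zero_iff_dvd.1 (h3.symm.trans (Nat.modEq_zero_iff_dvd.2 h1)))
    simpa using this
  exact (Nat.prime_dvd_prime_iff_eq hr Nat.prime_two).1 (hr.dvd_of_dvd_pow h4)

/-! ### Elements and intersections governed by `M` -/

theorem odd_index_of_card_eq {G : Type*} [CommGroup G] {q s : ℕ} (hs : Odd s)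
    (hG : Nat.card G = (q ^ s + 1) * (q ^ (2 * s) + 1)) {M : Subgroup G}
    (hM : Nat.card M = (q + 1) * (q ^ 2 + 1)) : Odd M.index := by
  obtain ⟨u, v, hu, hv, hu2, hv2, -⟩ := exists_cofactors (q := q) hs
  have h := M.card_mul_index
  rw [hM, hG, hu, hv, mul_mul_mul_comm] at h
  rw [Nat.eq_of_mul_eq_mul_left (by positivity) h]
  exact hu2.mul hv2

/-- It suffices to treat order `r ^ j`. If `r` does not divide the index of `M`, the element dies in
`G/M`. Otherwise `r` is odd and prime to `q - 1`, so `r ^ j` divides `|M|`; the hypothesis then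
makes the Sylow `r`-subgroup cyclic, with a single subgroup of order `r ^ j`. -/
theorem mem_of_pow_pow_four_sub_one_eq_one {G : Type*} [CommGroup G] [Finite G] {q s : ℕ} (hq : 1 ≤ q) (hs : Odd s)
    (hG : Nat.card G = (q ^ s + 1) * (q ^ (2 * s) + 1)) {M : Subgroup G}
    (hM : Nat.card M = (q + 1) * (q ^ 2 + 1))
    (hcyc : ∀ r : ℕ, r.Prime → (r ∣ Nat.gcd (q + 1) s ∨ r ∣ Nat.gcd (q ^ 2 + 1) s) →
      ∀ P : Sylow r G, IsCyclic P) {x : G}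
    (hx : x ^ ((q - 1) * ((q + 1) * (q ^ 2 + 1))) = 1) : x ∈ M := by
  refine M.mem_of_forall_prime_pow (fun y r j hr hj hy hd => ?_) hx
  have hy1 : y ^ r ^ j = 1 := hy ▸ pow_orderOf_eq_one y
  by_cases hri : r ∣ M.index
  · have hrv : r ∣ (q ^ s + 1) * (q ^ (2 * s) + 1) := by
      rw [← hG, ← M.card_mul_index]; exact hri.mul_left _
    have hr2 : r ≠ 2 := by
      rintro rfl
      exact (Nat.not_even_iff_odd.2 (odd_index_of_card_eq hs hG hM)) (even_iff_two_dvd.2 hri)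
    have hrq : ¬ r ∣ q - 1 := fun h => hr2 (hr.eq_two_of_dvd_sub_one hq hrv h)
    have hd' : r ^ j ∣ (q + 1) * (q ^ 2 + 1) :=
      (Nat.Coprime.pow_left j ((Nat.Prime.coprime_iff_not_dvd hr).2 hrq)).dvd_of_dvd_mul_left hd
    obtain ⟨u, v, hu, hv, -, -, huv⟩ := exists_cofactors (q := q) hs
    have hindex : M.index = u * v := by
      have h := M.card_mul_index
      rw [hM, hG, hu, hv, mul_mul_mul_comm] at h
      exact Nat.eq_of_mul_eq_mul_left (by positivity) h
    exact Subgroup.mem_of_isCyclic_sylow hr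
      (hcyc r hr (huv r hr (hindex ▸ hri) ((dvd_pow_self r hj.ne').trans hd'))) M hy1 (hM ▸ hd')
  · exact M.mem_of_pow_eq_one_of_coprime_index hy1
      (Nat.Coprime.pow_left j ((Nat.Prime.coprime_iff_not_dvd hr).2 hri))

/-- The order divides `gcd((q + 1)u, (q + 1)(q² + 1)) = q + 1`. Conversely a subgroup of `H` of
order `q + 1` is killed by `q⁴ - 1`, so it lies in `M`. -/
theorem card_inf_eq {G : Type*} [CommGroup G] [Finite G] {q s : ℕ} (hq : 1 ≤ q) (hs : Odd s)
    (hG : Nat.card G = (q ^ s + 1) * (q ^ (2 * s) + 1)) {M : Subgroup G}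
    (hM : Nat.card M = (q + 1) * (q ^ 2 + 1))
    (hcyc : ∀ r : ℕ, r.Prime → (r ∣ Nat.gcd (q + 1) s ∨ r ∣ Nat.gcd (q ^ 2 + 1) s) →
      ∀ P : Sylow r G, IsCyclic P) {H : Subgroup G} (hH : Nat.card H = q ^ s + 1) :
    Nat.card (H ⊓ M : Subgroup G) = q + 1 := by
  obtain ⟨u, v, hu, hv, hu2, -, -⟩ := exists_cofactors (q := q) hs
  apply Nat.dvd_antisymm
  · have h1 : Nat.card (H ⊓ M : Subgroup G) ∣ (q + 1) * u := by
      rw [← hu, ← hH]; exact Subgroup.card_dvd_of_le inf_le_left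
    have h2 : Nat.card (H ⊓ M : Subgroup G) ∣ (q + 1) * (q ^ 2 + 1) := by
      rw [← hM]; exact Subgroup.card_dvd_of_le inf_le_right
    have h3 := Nat.dvd_gcd h1 h2
    have hcop : u.Coprime (q ^ 2 + 1) := by
      refine Nat.Coprime.symm (Nat.coprime_of_dvd fun r hr h4 h5 => ?_)
      have : r = 2 := hr.eq_two_of_dvd_add_one_of_dvd_sq_add_one (x := q ^ s)
        (hu ▸ h5.mul_left _) (by rw [← pow_mul, mul_comm s, hv]; exact h4.mul_right _)
      subst this
      exact (Nat.not_even_iff_odd.2 hu2) (even_iff_two_dvd.2 h5)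
    rwa [Nat.gcd_mul_left, hcop, mul_one] at h3
  · obtain ⟨L, hL⟩ := CommGroup.exists_subgroup_card_eq (G := H) (d := q + 1)
      (by rw [hH, hu]; exact dvd_mul_right _ _)
    have hcard : Nat.card (L.map H.subtype) = q + 1 := by
      rw [← hL]
      exact (Nat.card_congr (L.equivMapOfInjective _ H.subtype_injective).toEquiv).symm
    rw [← hcard]
    refine Subgroup.card_dvd_of_le (le_inf (Subgroup.map_subtype_le L) fun x hx => ?_)
    refine mem_of_pow_pow_four_sub_one_eq_one hq hs hG hM hcyc ?_
    have h1 : x ^ (q + 1) = 1 := 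
      orderOf_dvd_iff_pow_eq_one.1 (hcard ▸ (L.map H.subtype).orderOf_dvd_natCard hx)
    rw [mul_left_comm, pow_mul, h1, one_pow]

/-! ### Coset representatives and the shape of `D ∩ M` -/

theorem exists_isCosetRepresentatives {G : Type*} [CommGroup G] [Finite G] {A M : Subgroup G}
    {N : ℕ} (hle : A ≤ M) (hcard : Nat.card M = Nat.card A * (N + 1)) {z : G} (hz : z ∈ M) :
    ∃ m : Fin (N + 1) → G, IsCosetRepresentatives A M m ∧ m 0 = z := by
  have hA : Nat.card (A.subgroupOf M) = Nat.card A :=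
    Nat.card_congr (Subgroup.subgroupOfEquivOfLe hle).toEquiv
  have hindex : Nat.card (M ⧸ A.subgroupOf M) = N + 1 := by
    have h := (A.subgroupOf M).card_mul_index
    rw [hA, hcard] at h
    exact Nat.eq_of_mul_eq_mul_left Nat.card_pos h
  let e₀ : Fin (N + 1) ≃ M ⧸ A.subgroupOf M := (Finite.equivFinOfCardEq hindex).symm
  let z' : M ⧸ A.subgroupOf M := QuotientGroup.mk ⟨z, hz⟩
  -- The swap moves the coset of `z` to index 0.
  let e : Fin (N + 1) ≃ M ⧸ A.subgroupOf M := (Equiv.swap 0 (e₀.symm z')).trans e₀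
  have he0 : e 0 = z' := by simp [e]
  let m : Fin (N + 1) → M := fun i => if i = 0 then ⟨z, hz⟩ else (e i).out
  have hm : ∀ i, (m i : M ⧸ A.subgroupOf M) = e i := by
    intro i
    by_cases h : i = 0
    · simp only [m, h, if_true, he0, z']
    · simp only [m, h, if_false, QuotientGroup.out_eq']
  refine ⟨fun i => m i, ⟨fun i => (m i).2, fun x hx => ?_⟩, by simp [m]⟩
  have key : ∀ i, x * (m i : G)⁻¹ ∈ A ↔ i = e.symm (QuotientGroup.mk ⟨x, hx⟩) := by
    intro i
    rw [Equiv.eq_symm_apply, ← hm i, QuotientGroup.eq, Subgroup.mem_subgroupOf, mul_comm]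
    rfl
  exact ⟨_, (key _).2 rfl, fun i hi => (key i).1 hi⟩

/-- Each coset of `H ⊓ M` in `M` lies in a different coset of `H`. The exceptional one contributes
`(H ⊓ M)z`; each of the `N` others contributes its unique element of `D`, which `hfix` keeps inside
`M`. -/
theorem inter_eq_of_coset {G : Type*} [CommGroup G] [Finite G] {D : Finset G} {H M : Subgroup G}
    {c : G ⧸ H} (hcD : ∀ g : G, (g : G ⧸ H) = c → g ∈ D)
    (hc : ∀ g : G, (g : G ⧸ H) ≠ c → ∃! d : G, d ∈ D ∧ (d : G ⧸ H) = g)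
    (hfix : ∀ d ∈ D, ∀ x ∈ M, (d : G ⧸ H) = x → (x : G ⧸ H) ≠ c → d ∈ M)
    {z : G} (hz : (z : G ⧸ H) = c) (hzM : z ∈ M) {N : ℕ} {m : Fin (N + 1) → G}
    (hm : IsCosetRepresentatives (H ⊓ M) M m) (hm0 : m 0 = z) :
    ∃ h : Fin (N + 1) → G,
      (∀ i, i ≠ 0 → h i ∈ H ⊓ M ∧ ∀ x ∈ H, x * m i ∈ D ↔ x = h i) ∧
      (D : Set G) ∩ (M : Set G) =
        {g | ∃ a ∈ H ⊓ M, g = a * z} ∪ {g | ∃ i, i ≠ 0 ∧ g = h i * m i} ∧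
      ((D : Set G) ∩ (M : Set G)).ncard = Nat.card (H ⊓ M : Subgroup G) + N := by
  obtain ⟨hmM, hrep⟩ := hm
  have huniq : ∀ i j, m i * (m j)⁻¹ ∈ H → i = j := by
    intro i j hij
    refine (hrep _ (hmM i)).unique ?_ ⟨hij, M.mul_mem (hmM i) (M.inv_mem (hmM j))⟩
    rw [mul_inv_cancel]
    exact (H ⊓ M).one_mem
  have hmul : ∀ x ∈ H, ∀ g : G, ((x * g : G) : G ⧸ H) = g := by
    intro x hx g
    rw [eq_comm, QuotientGroup.eq, mul_comm x, inv_mul_cancel_left]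
    exact hx
  have hmc : ∀ i, i ≠ 0 → (m i : G ⧸ H) ≠ c := by
    intro i hi h
    rw [← hz, eq_comm, QuotientGroup.eq, ← hm0, mul_comm] at h
    exact hi (huniq i 0 h)
  have hex : ∀ i, ∃ h : G, i ≠ 0 → h ∈ H ⊓ M ∧ ∀ x ∈ H, x * m i ∈ D ↔ x = h := by
    intro i
    by_cases hi : i = 0
    · exact ⟨1, fun h => absurd hi h⟩
    obtain ⟨d, ⟨hdD, hdm⟩, hd⟩ := hc (m i) (hmc i hi)
    have hdM : d ∈ M := hfix d hdD _ (hmM i) hdm (hmc i hi)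
    have hdH : d * (m i)⁻¹ ∈ H := by
      rw [mul_comm, ← QuotientGroup.eq, hdm]
    refine ⟨d * (m i)⁻¹, fun _ => ⟨⟨hdH, M.mul_mem hdM (M.inv_mem (hmM i))⟩, fun x hx => ?_⟩⟩
    rw [eq_mul_inv_iff_mul_eq]
    refine ⟨fun h => hd _ ⟨h, hmul x hx _⟩, fun h => h ▸ hdD⟩
  choose h hh using hex
  have hset : (D : Set G) ∩ (M : Set G) =
      {g | ∃ a ∈ H ⊓ M, g = a * z} ∪ {g | ∃ i, i ≠ 0 ∧ g = h i * m i} := by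
    ext g
    constructor
    · rintro ⟨hgD, hgM⟩
      obtain ⟨i, hi, -⟩ := hrep g hgM
      by_cases hi0 : i = 0
      · subst hi0
        exact Or.inl ⟨_, hi, by simp [hm0]⟩
      · have h1 := (((hh i hi0).2 _ hi.1).1 (by simpa using hgD))
        exact Or.inr ⟨i, hi0, by rw [← h1]; simp⟩
    · rintro (⟨a, ha, rfl⟩ | ⟨i, hi, rfl⟩)
      · exact ⟨hcD _ ((hmul a ha.1 z).trans hz), M.mul_mem ha.2 hzM⟩
      · exact ⟨((hh i hi).2 _ (hh i hi).1.1).2 rfl, M.mul_mem (hh i hi).1.2 (hmM i)⟩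
  refine ⟨h, hh, hset, ?_⟩
  have h1 : {g | ∃ a ∈ H ⊓ M, g = a * z} = (fun a => a * z) '' ((H ⊓ M : Subgroup G) : Set G) := by
    ext g
    simp only [Set.mem_ofPred_eq, Set.mem_image, SetLike.mem_coe, eq_comm]
  have h2 : {g | ∃ i, i ≠ 0 ∧ g = h i * m i} = (fun i => h i * m i) '' ({0}ᶜ : Set (Fin (N + 1))) := by
    ext g
    simp only [Set.mem_ofPred_eq, Set.mem_image, Set.mem_compl_iff, Set.mem_singleton_iff, eq_comm,
      ne_eq]
  have hinj : Set.InjOn (fun i => h i * m i) ({0}ᶜ : Set (Fin (N + 1))) := by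
    intro i hi j hj hij
    apply huniq
    have h3 : (m i : G ⧸ H) = m j := by
      rw [← hmul _ (hh i hi).1.1 (m i), ← hmul _ (hh j hj).1.1 (m j)]
      exact congrArg _ hij
    rw [eq_comm, QuotientGroup.eq, mul_comm] at h3
    exact h3
  have hdisj : Disjoint {g | ∃ a ∈ H ⊓ M, g = a * z} {g | ∃ i, i ≠ 0 ∧ g = h i * m i} := by
    rw [Set.disjoint_left]
    rintro _ ⟨a, ha, rfl⟩ ⟨i, hi, hai⟩
    apply hmc i hi
    rw [← hmul _ (hh i hi).1.1 (m i), ← hai, hmul a ha.1, hz]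
  rw [hset, Set.ncard_union_eq hdisj (Set.toFinite _) (Set.toFinite _), h1, h2,
    Set.ncard_image_of_injective _ (mul_left_injective z), hinj.ncard_image,
    Set.ncard_compl, Set.ncard_singleton]
  rw [← Nat.card_coe_set_eq, Nat.card_fin, Nat.add_sub_cancel]
  rfl

/-! ### The Sylow 2-subgroup -/

/-- For odd `Q` the factor `Q² + 1` is twice an odd number, so `|P|` is twice the 2-part of `Q + 1`.
-/
theorem Sylow.card_two_dvd {G : Type*} [CommGroup G] [Finite G] {Q : ℕ} (hQ : Odd Q)
    (hG : Nat.card G = (Q + 1) * (Q ^ 2 + 1)) (P : Sylow 2 G) :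
    ∃ n, Nat.card P = 2 ^ n ∧ ¬ 2 ^ n ∣ Q + 1 ∧ ∀ i < n, 2 ^ i ∣ Q + 1 := by
  obtain ⟨t, ht⟩ := hQ
  obtain ⟨w, hw, hw'⟩ : ∃ w, Odd w ∧ Q ^ 2 + 1 = 2 * w :=
    ⟨2 * (t ^ 2 + t) + 1, ⟨_, rfl⟩, by rw [ht]; ring⟩
  refine ⟨_, P.card_eq_multiplicity, fun h => ?_, fun i hi => ?_⟩
  · refine Nat.pow_succ_factorization_not_dvd (n := Nat.card G) Nat.card_pos.ne' Nat.prime_two ?_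
    conv_rhs => rw [hG, hw']
    rw [pow_succ]
    exact mul_dvd_mul h (dvd_mul_right _ _)
  · have h1 : 2 ^ (i + 1) ∣ Nat.card G :=
      (pow_dvd_pow 2 hi).trans (Nat.ordProj_dvd _ _)
    rw [hG, hw', pow_succ', mul_left_comm] at h1
    have h2 := Nat.dvd_of_mul_dvd_mul_left two_pos h1
    exact ((Nat.coprime_two_left.2 hw).pow_left i).dvd_of_dvd_mul_right h2

theorem Sylow.two_eq_bot_of_odd {G : Type*} [Group G] [Finite G] (hG : Odd (Nat.card G))
    (P : Sylow 2 G) : (P : Subgroup G) = ⊥ := by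
  obtain ⟨n, hn⟩ : ∃ n, Nat.card P = 2 ^ n := ⟨_, P.card_eq_multiplicity⟩
  rw [Subgroup.eq_bot_iff_card]
  exact Nat.eq_one_of_dvd_coprimes ((Nat.coprime_two_left.2 hG).pow_left n) (dvd_of_eq hn)
    (Subgroup.card_subgroup_dvd_card _)

/-- For odd `Q`, `P` is too large to lie in `H`. An element of `P` outside `H` must have order
`|P|`: a smaller order would divide `Q + 1` and place it in a subgroup of order `Q + 1`, that is, in
`H`. -/
theorem Sylow.exists_zpowers_eq_two {G : Type*} [CommGroup G] [Finite G] {Q : ℕ}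
    (hG : Nat.card G = (Q + 1) * (Q ^ 2 + 1)) {H : Subgroup G}
    (hH : ∀ K : Subgroup G, Nat.card K = Q + 1 → K = H) (P : Sylow 2 G) :
    ∃ g, Subgroup.zpowers g = (P : Subgroup G) := by
  rcases Nat.even_or_odd Q with hQ | hQ
  · refine ⟨1, ?_⟩
    rw [Subgroup.zpowers_one_eq_bot, P.two_eq_bot_of_odd]
    exact hG ▸ hQ.add_one.mul ((hQ.pow_of_ne_zero two_ne_zero).add_one)
  · have hdvd : Q + 1 ∣ Nat.card G := hG ▸ dvd_mul_right _ _
    obtain ⟨n, hn, hndvd, hlt⟩ := P.card_two_dvd hQ hG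
    obtain ⟨K, hK⟩ := CommGroup.exists_subgroup_card_eq hdvd
    obtain ⟨g, hgP, hg⟩ : ∃ g ∈ (P : Subgroup G), g ∉ H := by
      by_contra! h
      have h1 := Subgroup.card_dvd_of_le (H := (P : Subgroup G)) (K := H) h
      rw [← hH K hK, hK] at h1
      exact hndvd (hn ▸ h1)
    have h2 : orderOf g ∣ 2 ^ n := hn ▸ (P : Subgroup G).orderOf_dvd_natCard hgP
    obtain ⟨i, hi, hi'⟩ := (Nat.dvd_prime_pow Nat.prime_two).1 h2
    have hin : i = n := by
      by_contra hne
      have h3 : Nat.card (Subgroup.zpowers g) ∣ Q + 1 := by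
        rw [Nat.card_zpowers, hi']
        exact hlt i (lt_of_le_of_ne hi hne)
      obtain ⟨L, hL, hLcard⟩ := (Subgroup.zpowers g).exists_le_card_eq h3 hdvd
      exact hg (hH L hLcard ▸ hL (Subgroup.mem_zpowers g))
    refine ⟨g, Subgroup.eq_of_le_of_card_ge (Subgroup.zpowers_le.2 hgP) ?_⟩
    rw [Nat.card_zpowers, hi', hin]
    exact hn.le

/-! ### Multipliers for the parameters of `PG(3, Q)` -/

namespace IsDifferenceSet

variable {G : Type*} [CommGroup G] [Fintype G] {D : Finset G}

theorem pow_prime_pow_mem {p e : ℕ} (hp : p.Prime) (he : 0 < e)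
    (hD : IsDifferenceSet D ((p ^ e + 1) * ((p ^ e) ^ 2 + 1)) ((p ^ e) ^ 2 + p ^ e + 1) (p ^ e + 1))
    (hnorm : IsNormalized D) (j : ℕ) : ∀ d ∈ D, d ^ p ^ j ∈ D := by
  have hQ2 : 2 ≤ p ^ e := hp.two_le.trans (Nat.le_self_pow he.ne' p)
  have hmem := hD.pow_mem hnorm (a := 2 * e) hp
    (by
      rw [Nat.Prime.coprime_iff_not_dvd hp, hp.dvd_mul, not_or]
      have h1 : p ∣ p ^ e := dvd_pow_self p he.ne'
      have h2 : p ∣ (p ^ e) ^ 2 := dvd_pow h1 two_ne_zero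
      exact ⟨fun h => hp.one_lt.ne' (Nat.dvd_one.1 ((Nat.dvd_add_right h1).1 h)),
        fun h => hp.one_lt.ne' (Nat.dvd_one.1 ((Nat.dvd_add_right h2).1 h))⟩)
    (by rw [mul_comm 2 e, pow_mul]; ring)
    (by rw [mul_comm 2 e, pow_mul]; nlinarith)
    (by
      have h1 : ((p ^ e) ^ 2 + p ^ e + 1).Coprime (p ^ e + 1) := by
        rw [show (p ^ e) ^ 2 + p ^ e + 1 = 1 + (p ^ e) * (p ^ e + 1) by ring]
        simp
      have h2 : ((p ^ e) ^ 2 + p ^ e + 1).Coprime ((p ^ e) ^ 2 + 1) := by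
        rw [show (p ^ e) ^ 2 + p ^ e + 1 = p ^ e + ((p ^ e) ^ 2 + 1) by ring,
          Nat.coprime_add_self_left, show (p ^ e) ^ 2 + 1 = 1 + p ^ e * p ^ e by ring]
        simp
      exact h1.mul_right h2)
  induction j with
  | zero => simp
  | succ j ih =>
    intro d hd
    rw [pow_succ, pow_mul]
    exact hmem _ (ih d hd)

theorem powMap_sq_eq {p e : ℕ} (hp : p.Prime) (he : 0 < e)
    (hD : IsDifferenceSet D ((p ^ e + 1) * ((p ^ e) ^ 2 + 1)) ((p ^ e) ^ 2 + p ^ e + 1) (p ^ e + 1))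
    (hnorm : IsNormalized D) : powMap G ((p ^ e) ^ 2) (groupRingSum D) = groupRingSum D := by
  apply groupRingSum_image
  · have hcop : (Nat.card G).Coprime ((p ^ e) ^ 2) := by
      rw [Nat.card_eq_fintype_card, hD.card_group]
      refine Nat.Coprime.pow_right _ (Nat.Coprime.mul_left ?_ ?_)
      · simp
      · rw [sq]; simp
    exact (powCoprime hcop).injective
  · have := hD.pow_prime_pow_mem hp he hnorm (e * 2)
    rwa [pow_mul] at this

end IsDifferenceSet

/-- For odd `Q` the order of `z` does not divide `Q + 1`, so `z` maps to a nontrivial 2-element of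
`G/H`; the only one is the involution `c`. -/
theorem coe_generator_sylow_two_eq {G : Type*} [CommGroup G] [Finite G] {Q : ℕ}
    (hG : Nat.card G = (Q + 1) * (Q ^ 2 + 1)) {H : Subgroup G} (hH : Nat.card H = Q + 1)
    {c : G ⧸ H} (hcc : c * c = 1) (hc1 : c = 1 ↔ Even Q) (P : Sylow 2 G) {z : G}
    (hz : Subgroup.zpowers z = (P : Subgroup G)) : (z : G ⧸ H) = c := by
  rcases Nat.even_or_odd Q with hQ | hQ
  · rw [P.two_eq_bot_of_odd (hG ▸ hQ.add_one.mul ((hQ.pow_of_ne_zero two_ne_zero).add_one)),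
      Subgroup.zpowers_eq_bot] at hz
    rw [hz, hc1.2 hQ, QuotientGroup.mk_one]
  · obtain ⟨n, hn, hndvd, -⟩ := P.card_two_dvd hQ hG
    have horder : orderOf z = 2 ^ n := by
      rw [← Nat.card_zpowers, hz]; exact hn
    have hz1 : (z : G ⧸ H) ≠ 1 := by
      intro h
      rw [QuotientGroup.eq_one_iff] at h
      exact hndvd (horder ▸ hH ▸ H.orderOf_dvd_natCard h)
    obtain ⟨t, ht⟩ := hQ
    have hΓ : Nat.card (G ⧸ H) = 2 * (2 * (t ^ 2 + t) + 1) := by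
      have h := H.card_mul_index
      rw [hH, hG] at h
      rw [← Subgroup.index_eq_card, Nat.eq_of_mul_eq_mul_left (Nat.succ_pos Q) h, ht]
      ring
    refine CommGroup.eq_of_card_eq_two_mul_odd ⟨_, rfl⟩ hΓ ?_ hcc hz1 (j := n) ?_
    · rw [Ne, hc1, Nat.not_even_iff_odd]
      exact ⟨t, ht⟩
    · rw [← QuotientGroup.mk_pow, ← horder, pow_orderOf_eq_one, QuotientGroup.mk_one]

/-! ### The theorem -/

theorem lemma4p2 {G : Type*} [CommGroup G] [Fintype G] (q s : ℕ) (hq : IsPrimePow q)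
    (hs : Odd s) (D : Finset G)
    (hD : IsDifferenceSet D ((q ^ s + 1) * (q ^ (2 * s) + 1)) (q ^ (2 * s) + q ^ s + 1) (q ^ s + 1))
    (hnorm : IsNormalized D)
    (M : Subgroup G) (hM : Nat.card M = (q + 1) * (q ^ 2 + 1))
    (hcyc : ∀ r : ℕ, r.Prime → (r ∣ Nat.gcd (q + 1) s ∨ r ∣ Nat.gcd (q ^ 2 + 1) s) →
      ∀ P : Sylow r G, IsCyclic P) :
    ((D : Set G) ∩ (M : Set G)).ncard = q ^ 2 + q + 1 ∧
    (∃! H : Subgroup G, Nat.card H = q ^ s + 1) ∧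
    (∀ P : Sylow 2 G, IsCyclic P ∧ (P : Subgroup G) ≤ M) ∧
    ∀ H : Subgroup G, Nat.card H = q ^ s + 1 →
      Nat.card (H ⊓ M : Subgroup G) = q + 1 ∧
      ∀ (P : Sylow 2 G) (z : G), Subgroup.zpowers z = (P : Subgroup G) →
        ∀ m : Fin (q ^ 2 + 1) → G, IsCosetRepresentatives (H ⊓ M) M m → m 0 = z →
          ∃ h : Fin (q ^ 2 + 1) → G,
            (∀ i, i ≠ 0 → h i ∈ H ⊓ M ∧ ∀ x ∈ H, x * m i ∈ D ↔ x = h i) ∧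
            (D : Set G) ∩ (M : Set G) =
              {g | ∃ a ∈ H ⊓ M, g = a * z} ∪ {g | ∃ i, i ≠ 0 ∧ g = h i * m i} := by
  obtain ⟨p, f, hp, hf, hpf⟩ := (isPrimePow_nat_iff q).1 hq
  have hq1 : 1 ≤ q := hq.pos
  have hG' : Nat.card G = (q ^ s + 1) * (q ^ (2 * s) + 1) := by
    rw [Nat.card_eq_fintype_card, hD.card_group]
  have hsq : q ^ (2 * s) = (q ^ s) ^ 2 := by rw [← pow_mul, mul_comm]
  have hG : Nat.card G = (q ^ s + 1) * ((q ^ s) ^ 2 + 1) := by rw [hG', hsq]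
  have he : 0 < f * s := Nat.mul_pos hf hs.pos
  have hQ : q ^ s = p ^ (f * s) := by rw [← hpf, pow_mul]
  rw [hsq, hQ] at hD
  have hpow := hD.powMap_sq_eq hp he hnorm
  obtain ⟨H₀, hH₀⟩ := CommGroup.exists_subgroup_card_eq (G := G) (d := q ^ s + 1)
    (hG ▸ dvd_mul_right _ _)
  have hunique : ∀ K : Subgroup G, Nat.card K = q ^ s + 1 → K = H₀ := fun K hK =>
    hD.eq_of_card_eq hp he hnorm hpow (hQ ▸ hK) (hQ ▸ hH₀)
  have hPM : ∀ P : Sylow 2 G, (P : Subgroup G) ≤ M := by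
    intro P x hx
    obtain ⟨n, hn⟩ : ∃ n, Nat.card P = 2 ^ n := ⟨_, P.card_eq_multiplicity⟩
    refine M.mem_of_pow_eq_one_of_coprime_index (n := 2 ^ n)
      (orderOf_dvd_iff_pow_eq_one.1 (hn ▸ (P : Subgroup G).orderOf_dvd_natCard hx)) ?_
    exact (Nat.coprime_two_left.2 (odd_index_of_card_eq hs hG' hM)).pow_left n
  have hcard : ∀ H : Subgroup G, Nat.card H = q ^ s + 1 → Nat.card (H ⊓ M : Subgroup G) = q + 1 :=
    fun H hH => card_inf_eq hq1 hs hG' hM hcyc hH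
  have hq4 : q ^ 4 = (q - 1) * ((q + 1) * (q ^ 2 + 1)) + 1 := by
    obtain ⟨r, rfl⟩ : ∃ r, q = r + 1 := ⟨q - 1, by omega⟩
    rw [Nat.add_sub_cancel]
    ring
  -- The cardinality is carried along so that one choice of `H`, `z` and `m` yields the first claim.
  have main : ∀ H : Subgroup G, Nat.card H = q ^ s + 1 → ∀ (P : Sylow 2 G) (z : G),
      Subgroup.zpowers z = (P : Subgroup G) →
        ∀ m : Fin (q ^ 2 + 1) → G, IsCosetRepresentatives (H ⊓ M) M m → m 0 = z →
          ∃ h : Fin (q ^ 2 + 1) → G,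
            (∀ i, i ≠ 0 → h i ∈ H ⊓ M ∧ ∀ x ∈ H, x * m i ∈ D ↔ x = h i) ∧
            (D : Set G) ∩ (M : Set G) =
              {g | ∃ a ∈ H ⊓ M, g = a * z} ∪ {g | ∃ i, i ≠ 0 ∧ g = h i * m i} ∧
            ((D : Set G) ∩ (M : Set G)).ncard = Nat.card (H ⊓ M : Subgroup G) + q ^ 2 := by
    intro H hH P z hz m hm hm0
    obtain ⟨c, hcc, hc1, hcD, hc⟩ := hD.exists_coset hp he hnorm hpow H (hQ ▸ hH)
    have hzM : z ∈ M := hPM P (hz ▸ Subgroup.mem_zpowers z)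
    refine inter_eq_of_coset hcD hc ?_
      (coe_generator_sylow_two_eq hG hH hcc (hQ ▸ hc1) P hz) hzM hm hm0
    intro d hd x hx hdx hxc
    have hxpow : x ^ q ^ 4 = x := by
      have h1 : x ^ ((q + 1) * (q ^ 2 + 1)) = 1 :=
        orderOf_dvd_iff_pow_eq_one.1 (hM ▸ M.orderOf_dvd_natCard hx)
      rw [hq4, pow_succ, mul_comm (q - 1), pow_mul, h1, one_pow, one_mul]
    -- `d ^ q ^ 4` is in `D` and in the coset `xH`, where `d` is the only element of `D`.
    have hdpow : d ^ q ^ 4 = d := by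
      have h1 := hD.pow_prime_pow_mem hp he hnorm (f * 4) d hd
      rw [pow_mul, hpf] at h1
      refine (hc x hxc).unique ⟨h1, ?_⟩ ⟨hd, hdx⟩
      rw [QuotientGroup.mk_pow, hdx, ← QuotientGroup.mk_pow, hxpow]
    refine mem_of_pow_pow_four_sub_one_eq_one hq1 hs hG' hM hcyc ?_
    rwa [hq4, pow_succ, mul_eq_right] at hdpow
  refine ⟨?_, ⟨H₀, hH₀, hunique⟩, fun P => ⟨?_, hPM P⟩, fun H hH => ⟨hcard H hH, ?_⟩⟩
  · obtain ⟨P⟩ : Nonempty (Sylow 2 G) := inferInstance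
    obtain ⟨z, hz⟩ := P.exists_zpowers_eq_two hG hunique
    obtain ⟨m, hm, hm0⟩ := exists_isCosetRepresentatives (A := H₀ ⊓ M) (M := M) (N := q ^ 2)
      inf_le_right (by rw [hM, hcard H₀ hH₀]) (hPM P (hz ▸ Subgroup.mem_zpowers z))
    obtain ⟨-, -, -, h⟩ := main H₀ hH₀ P z hz m hm hm0
    rw [h, hcard H₀ hH₀]
    ring
  · exact (Subgroup.isCyclic_iff_exists_zpowers_eq_top _).2 (P.exists_zpowers_eq_two hG hunique)
  · intro P z hz m hm hm0
    obtain ⟨h, h1, h2, -⟩ := main H hH P z hz m hm hm0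
    exact ⟨h, h1, h2⟩
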